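/- Let $(\Omega,\mathcal A,\mathbb P)$ be a probability space, $\theta:\Omega\to\Omega$ a bijective bimeasurable transformation preserving $\mathbb P$, and $\mathcal F_0\subseteq\mathcal A$ a $\sigma$-algebra with $\mathcal F_0\subseteq\theta^{-1}(\mathcal F_0)$; put $\mathcal F_i=\theta^{-i}(\mathcal F_0)$ for $i\in\mathbb Z$. Let $1<p<2$, let $\mathcal H$ be a real separable Hilbert space with norm $|\cdot|_{\mathcal H}$, and let $X_0$ be an $\mathcal F_0$-measurable, centered, $\mathcal H$-valued random variable with $\mathbb E|X_0|_{\mathcal H}^p<\infty$. Set $X_i=X_0\circ\theta^i$ for $i\in\mathbb Z$, $S_n=X_1+\dots+X_n$, $\mathbb E_k(Y)=\mathbb E(Y\mid\mathcal F_k)$, $\mathcal P_k(Y)=\mathbb E_k(Y)-\mathbb E_{k-1}(Y)$ and $\|Y\|_{p,\mathcal H}=(\mathbb E|Y|_{\mathcal H}^p)^{1/p}$. Assume that at least one of the following two conditions holds: 1. $\displaystyle\sum_{n\ge2}\log n\,\frac{\|\mathbb E_0(S_n)\|_{p,\mathcal H}}{n^{3/2}}<\infty$; 2. $\displaystyle\sum_{n\ge2}\log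 n\,\|\mathcal P_0(X_n)\|_{p,\mathcal H}<\infty$ and $\|\mathbb E_0(X_n)\|_{p,\mathcal H}\to0$ as $n\to\infty$ (the latter is equivalent to $\mathbb E\big(X_0\mid\bigcap_{i\in\mathbb Z}\mathcal F_i\big)=0$ a.s.). Then $(X_n)_{n\in\mathbb Z}$ admits a martingale approximation in $\mathbb L^p(\mathcal H)$ with rate $n^{1/p}$, that is, there exists $D\in\mathbb L^p(\mathcal H)$ such that $M_n=\sum_{k=1}^n D\circ\theta^k$, $n\ge1$, is a martingale adapted to $(\mathcal F_n)_{n\ge1}$ and $\|S_n-M_n\|_{p,\mathcal H}=o(n^{1/p})$. In addition, $|S_n|_{\mathcal H}=o(n^{1/p})$ almost surely. -/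

import Mathlib

open MeasureTheory Filter Asymptotics
open scoped ENNReal Topology

namespace StationaryApprox

variable {Ω H : Type*}

/-- The integer iterate `θ ^ i : Ω → Ω` of a bijective bimeasurable transformation. -/
def iter {mΩ : MeasurableSpace Ω} (θ : Ω ≃ᵐ Ω) (i : ℤ) : Ω → Ω := ⇑((θ.toEquiv : Equiv.Perm Ω) ^ i)

/-- The σ-algebra `ℱ i = θ ^ (-i) (ℱ₀)`, consisting of the preimages under `θ ^ i` of the
elements of `ℱ₀`. -/
@[reducible]
def sigmaAt (F₀ : MeasurableSpace Ω) {mΩ : MeasurableSpace Ω} (θ : Ω ≃ᵐ Ω) (i : ℤ) : MeasurableSpace Ω :=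
  F₀.comap (iter θ i)

theorem iter_succ {mΩ : MeasurableSpace Ω} (θ : Ω ≃ᵐ Ω) (i : ℤ) : iter θ (i + 1) = θ ∘ iter θ i := by
  funext ω
  simp only [iter, Function.comp_apply]
  rw [add_comm, zpow_add, zpow_one]
  rfl

theorem measurable_iter {mΩ : MeasurableSpace Ω} (θ : Ω ≃ᵐ Ω) (i : ℤ) : Measurable (iter θ i) := by
  induction i with
  | zero => exact measurable_id
  | succ n ih =>
    rw [iter_succ]
    exact θ.measurable.comp ih
  | pred n ih =>
    have h : iter θ (-(n : ℤ)) = θ ∘ iter θ (-(n : ℤ) - 1) := by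
      rw [← iter_succ, sub_add_cancel]
    have h' : iter θ (-(n : ℤ) - 1) = θ.symm ∘ iter θ (-(n : ℤ)) := by
      rw [h]
      funext ω
      simp
    rw [h']
    exact θ.symm.measurable.comp ih

/-- The nondecreasing filtration `(ℱ i)` indexed by `ℤ`, for `ℱ₀` a sub-σ-algebra with
`ℱ₀ ⊆ θ⁻¹ (ℱ₀)`. -/
def filtration (F₀ : MeasurableSpace Ω) {mΩ : MeasurableSpace Ω} (θ : Ω ≃ᵐ Ω)
    (hle : F₀ ≤ mΩ) (hmono : F₀ ≤ F₀.comap θ) : Filtration ℤ mΩ where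
  seq := sigmaAt F₀ θ
  mono' := by
    refine monotone_int_of_le_succ fun i => ?_
    unfold sigmaAt
    rw [iter_succ, ← MeasurableSpace.comap_comp]
    exact MeasurableSpace.comap_mono hmono
  le' := fun i =>
    (MeasurableSpace.comap_mono hle).trans (measurable_iter θ i).comap_le

/-- The part `(ℱ n)`, `n ≥ 1`, of the filtration; its `n`-th term is `ℱ (n + 1)`. -/
def posFiltration (F₀ : MeasurableSpace Ω) {mΩ : MeasurableSpace Ω} (θ : Ω ≃ᵐ Ω)
    (hle : F₀ ≤ mΩ) (hmono : F₀ ≤ F₀.comap θ) : Filtration ℕ mΩ where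
  seq := fun n => filtration F₀ θ hle hmono ((n : ℤ) + 1)
  mono' := fun m n hmn => (filtration F₀ θ hle hmono).mono (by omega)
  le' := fun n => (filtration F₀ θ hle hmono).le _

/-- `f ∘ θ ^ 1 + ⋯ + f ∘ θ ^ n`. For `f = X₀` this is `S n = X 1 + ⋯ + X n`. -/
def partialSum [AddCommMonoid H] {mΩ : MeasurableSpace Ω} (θ : Ω ≃ᵐ Ω) (f : Ω → H) (n : ℕ) : Ω → H :=
  fun ω => ∑ k ∈ Finset.Icc 1 n, f (iter θ (k : ℤ) ω)

variable [NormedAddCommGroup H] [InnerProductSpace ℝ H] [CompleteSpace H]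

/-- The conditional expectation `E_k (Y) = E (Y | ℱ k)`. -/
noncomputable def condE (F₀ : MeasurableSpace Ω) {mΩ : MeasurableSpace Ω} (θ : Ω ≃ᵐ Ω)
    (μ : Measure Ω) (k : ℤ) (Y : Ω → H) : Ω → H :=
  μ[Y | sigmaAt F₀ θ k]

/-- The projection `P_k (Y) = E_k (Y) - E_{k-1} (Y)`. -/
noncomputable def proj (F₀ : MeasurableSpace Ω) {mΩ : MeasurableSpace Ω} (θ : Ω ≃ᵐ Ω)
    (μ : Measure Ω) (k : ℤ) (Y : Ω → H) : Ω → H :=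
  condE F₀ θ μ k Y - condE F₀ θ μ (k - 1) Y

/-- The stationary sequence `X i = X₀ ∘ θ ^ i` admits a martingale approximation in `L^p (H)` with
rate `r`: there is `D ∈ L^p (H)` such that `M n = ∑_{k=1}^n D ∘ θ ^ k`, `n ≥ 1`, is a martingale
adapted to `(ℱ n)`, `n ≥ 1`, and `‖S n - M n‖_{p,H} = o (r n)`. -/
def HasMartingaleApprox (F₀ : MeasurableSpace Ω) {mΩ : MeasurableSpace Ω} (θ : Ω ≃ᵐ Ω)
    (hle : F₀ ≤ mΩ) (hmono : F₀ ≤ F₀.comap θ) (μ : Measure Ω) (X₀ : Ω → H) (p : ℝ) (r : ℕ → ℝ) : Prop :=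
  ∃ D : Ω → H, MemLp D (ENNReal.ofReal p) μ ∧
    Martingale (fun n : ℕ => partialSum θ D (n + 1)) (posFiltration F₀ θ hle hmono) μ ∧
    (fun n : ℕ =>
      (eLpNorm (partialSum θ X₀ n - partialSum θ D n) (ENNReal.ofReal p) μ).toReal)
        =o[atTop] r

end StationaryApprox

/-! Martingale approximation at rate `n ^ (1 / p)`, `1 < p < 2`, for stationary Hilbert-valued sequences.

The running maximum of a sum of stationary martingale differences satisfies a truncated weak-type bound
(`WeakBound`), which is turned by interpolation into an `L^p` bound, an integrable maximal function and
almost sure negligibility. Both conditions of the main theorem write the sequence as a series of such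
sums whose norms are summable: the projections of `X₀` for the second one, a dyadic decomposition
into martingale differences for powers of the transformation for the first one. -/

set_option linter.unusedSectionVars false

namespace StationaryApprox

/-! ### Dyadic sums of the truncation function -/

variable {Ω H : Type*}

/-! For `1 < p < 2` the partial sums of a stationary `L^p` martingale difference are themselves
`o(n^(1/p))`, in `L^p` and almost surely. It is therefore enough to dominate `|S_n|` by a process
that is `Negligible`; any stationary martingale difference, here `innovation`, can then serve as
`D`.

The basic estimate is `measure_two_mul_maxSum_le`: truncating the differences `d` at level `t` and
recentring, Doob's `L²` inequality for the small part and Markov's inequality for the large part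
bound the probability that the running maximum exceeds `2t` by `4n E min(|d|/t, |d|²/t²)`. Because
`1 < p < 2`, summing this over the levels `2^(r/p)` with weights `2^r` costs only a multiple of
`E|d|^p`. This gives an `L^p` bound, the `o(n)` refinement, and an integrable maximal function
`sup_n R_n / n^(1/p)` with mean at most `C ‖d‖_p`. By dominated convergence, a series of such maxima
run at steps `q_i` is negligible as soon as `∑ ‖d_i‖_p / q_i^(1/p) < ∞` (`negligible_tsum`).

Under the second condition, `X₀` is the sum of the differences `E_{-j} X₀ - E_{-j-1} X₀`, whose
norms are `‖P_0 X_j‖_p`. Under the first, remove the innovation and sum `u_0 = E_{-1} X₀` by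
repeated pairing: `u_r = E_{-2^r}(S_{2^r} ∘ θ^(-2^r))` satisfies `u_r ∘ θ^(-2^r) + u_r = d_r +
u_{r+1}`, with `d_r` a martingale difference for `θ^(2^(r+1))` (`enorm_sparseSum_le_tsum`). Here
`‖u_r‖_p = ‖E_0 S_{2^r}‖_p`, which is `O(2^(r/2))` by subadditivity (`subadditive_le_sqrt`), so
dividing by `2^(r/p)` leaves a convergent series. -/

/-- The function `t ↦ min t (t ^ 2)`. -/
noncomputable def minSq (t : ℝ≥0∞) : ℝ≥0∞ := min t (t ^ 2)

theorem measurable_minSq : Measurable minSq := measurable_id.min (measurable_id.pow_const 2)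

theorem minSq_mono : Monotone minSq := fun _ _ h =>
  min_le_min h (pow_le_pow_left' h 2)

/-- A two-sided geometric series: the square branch gives `2^(-r(2/p-1))` for `r ≥ 0` and the linear
branch gives `2^(r(1-1/p))` for `r ≤ 0`. Both exponents decay precisely because `1 < p < 2`. -/
theorem summable_dyadic_minSq {p : ℝ} (hp1 : 1 < p) (hp2 : p < 2) :
    ∑' r : ℤ, (2 : ℝ≥0∞) ^ r * minSq ((2 ^ (-r)) ^ (1 / p)) ≠ ∞ := by
  have hp0 : 0 < p := by linarith
  set c : ℝ := min (1 - 1 / p) (2 / p - 1) with hc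
  have hc1 : c ≤ 1 - 1 / p := min_le_left _ _
  have hc2 : c ≤ 2 / p - 1 := min_le_right _ _
  have hc0 : 0 < c := by
    refine lt_min ?_ ?_
    · rw [sub_pos, div_lt_one hp0]; exact hp1
    · rw [sub_pos, one_lt_div hp0]; exact hp2
  have hgeo : Summable fun n : ℕ => ((2 : ℝ) ^ (-c)) ^ n :=
    summable_geometric_of_lt_one
        (by positivity) (Real.rpow_lt_one_of_one_lt_of_neg (by norm_num) (by linarith))
  have hZ : Summable fun r : ℤ => ((2 : ℝ) ^ (-c * |(r : ℝ)|)) := by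
    refine Summable.of_nat_of_neg ?_ ?_ <;>
    · refine hgeo.congr fun n => ?_
      rw [← Real.rpow_natCast, ← Real.rpow_mul (by norm_num)]
      simp
  have hle : ∀ r : ℤ, (2 : ℝ≥0∞) ^ r * minSq ((2 ^ (-r)) ^ (1 / p)) ≤
      ENNReal.ofReal ((2 : ℝ) ^ (-c * |(r : ℝ)|)) := by
    intro r
    have e1 : (2 : ℝ≥0∞) ^ r = ENNReal.ofReal ((2 : ℝ) ^ (r : ℝ)) := by
      rw [← ENNReal.ofReal_rpow_of_pos (by norm_num), ENNReal.rpow_intCast]; norm_num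
    have e2 : ((2 : ℝ≥0∞) ^ (-r)) ^ (1 / p) = ENNReal.ofReal ((2 : ℝ) ^ (-(r : ℝ) * (1 / p))) := by
      rw [← ENNReal.rpow_intCast, ← ENNReal.rpow_mul,
        ← ENNReal.ofReal_rpow_of_pos (by norm_num)]
      norm_num
    rw [e1, e2, minSq]
    rcases le_total 0 (r : ℝ) with hr | hr
    · refine (mul_le_mul_right (min_le_right _ _) _).trans ?_
      rw [← ENNReal.ofReal_pow (by positivity), ← ENNReal.ofReal_mul (by positivity)]
      refine ENNReal.ofReal_le_ofReal ?_
      rw [← Real.rpow_natCast, ← Real.rpow_mul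
          (by norm_num), ← Real.rpow_add (by norm_num), abs_of_nonneg hr]
      refine Real.rpow_le_rpow_of_exponent_le (by norm_num) ?_
      push_cast
      have := mul_le_mul_of_nonneg_right hc2 hr
      have e : 2 / p * (r : ℝ) = r * (1 / p) * 2 := by ring
      linarith
    · refine (mul_le_mul_right (min_le_left _ _) _).trans ?_
      rw [← ENNReal.ofReal_mul (by positivity)]
      refine ENNReal.ofReal_le_ofReal ?_
      rw [← Real.rpow_add (by norm_num), abs_of_nonpos hr]
      refine Real.rpow_le_rpow_of_exponent_le (by norm_num) ?_
      have := mul_le_mul_of_nonpos_right hc1 hr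
      linarith
  refine ne_top_of_le_ne_top ?_ (ENNReal.tsum_le_tsum hle)
  exact hZ.tsum_ofReal_ne_top

/-- Scaling: if `2^R < y^p ≤ 2^(R+1)`, shifting the index by `R+1` turns the sum into the fixed
series above times `2^(R+1) ≤ 2 y^p`. -/
theorem exists_tsum_dyadic_minSq_le {p : ℝ} (hp1 : 1 < p) (hp2 : p < 2) :
    ∃ C : ℝ≥0∞, C ≠ 0 ∧ C ≠ ∞ ∧ ∀ y : ℝ≥0∞,
      ∑' r : ℤ, (2 : ℝ≥0∞) ^ r * minSq (y / (2 ^ r) ^ (1 / p)) ≤ C * y ^ p := by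
  have hp0 : 0 < p := by linarith
  set g := ∑' r : ℤ, (2 : ℝ≥0∞) ^ r * minSq ((2 ^ (-r)) ^ (1 / p)) with hg
  -- The `+ 1` makes the constant visibly nonzero, so that the right side is `∞` when `y = ∞`.
  refine ⟨2 * g + 1, by simp, by finiteness [summable_dyadic_minSq hp1 hp2], fun y => ?_⟩
  rcases eq_or_ne y 0 with rfl | hy0
  · simp [minSq]
  rcases eq_or_ne y ∞ with rfl | hyt
  · rw [ENNReal.top_rpow_of_pos hp0, ENNReal.mul_top (by simp)]
    exact le_top
  have hyp0 : y ^ p ≠ 0 := by simp [hy0, hp0.le]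
  obtain ⟨R, hR1, hR2⟩ := ENNReal.exists_mem_Ioc_zpow (y := 2) hyp0
      (by finiteness) (by norm_num) (by norm_num)
  have hy : y ≤ (2 ^ (R + 1)) ^ (1 / p) := by
    rw [one_div, ENNReal.le_rpow_inv_iff hp0]; exact hR2
  have h20 : (2 : ℝ≥0∞) ≠ 0 := by norm_num
  have h2t : (2 : ℝ≥0∞) ≠ ∞ := by norm_num
  calc ∑' r : ℤ, (2 : ℝ≥0∞) ^ r * minSq (y / (2 ^ r) ^ (1 / p))
      ≤ ∑' r : ℤ, (2 : ℝ≥0∞) ^ r * minSq ((2 ^ (R + 1)) ^ (1 / p) / (2 ^ r) ^ (1 / p)) :=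
        ENNReal.tsum_le_tsum fun r => mul_le_mul_right (minSq_mono
            (ENNReal.div_le_div_right hy _)) _
    _ = ∑' r : ℤ, (2 : ℝ≥0∞) ^ (r + (R + 1)) *
          minSq ((2 ^ (R + 1)) ^ (1 / p) / (2 ^ (r + (R + 1))) ^ (1 / p)) :=
        ((Equiv.addRight (R + 1)).tsum_eq _).symm
    _ = ∑' r : ℤ, 2 ^ (R + 1) * ((2 : ℝ≥0∞) ^ r * minSq ((2 ^ (-r)) ^ (1 / p))) := by
        refine tsum_congr fun r => ?_
        rw [← ENNReal.div_rpow_of_nonneg _ _ (by positivity), ENNReal.zpow_add h20 h2t r]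
        rw [← mul_assoc, mul_comm ((2 : ℝ≥0∞) ^ (R + 1)) (2 ^ r)]
        congr 4
        rw [ENNReal.zpow_neg, ← one_mul ((2 : ℝ≥0∞) ^ (R + 1)), ← mul_assoc, mul_one,
          ENNReal.mul_div_mul_right _ _ (ENNReal.zpow_pos h20 h2t _).ne'
            (ENNReal.zpow_lt_top h20 h2t _).ne, one_div]
    _ = 2 ^ (R + 1) * g := by rw [ENNReal.tsum_mul_left]
    _ ≤ (2 * g + 1) * y ^ p := by
        rw [ENNReal.zpow_add h20 h2t, zpow_one]
        calc (2 : ℝ≥0∞) ^ R * 2 * g ≤ y ^ p * 2 * g := by gcongr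
          _ = (2 * g) * y ^ p := by ring
          _ ≤ _ := by gcongr; exact le_self_add

/-! ### Interpolation and maximal functions from the weak-type bound -/

/-- A nondecreasing process `R` whose tails are controlled, linearly in time, by the truncated
second moments of `Y`, in the manner of the maximal function of the partial sums of a sequence of
martingale differences distributed as `Y`. -/
structure WeakBound {mΩ : MeasurableSpace Ω} (μ : Measure Ω) (R : ℕ → Ω → ℝ≥0∞) (Y : Ω → ℝ≥0∞) :
    Prop where
  measurable : ∀ n, Measurable (R n)
  measurable_bound : Measurable Y
  mono : ∀ ω, Monotone fun n => R n ω
  zero : ∀ ω, R 0 ω = 0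
  ne_top : ∀ n ω, R n ω ≠ ∞
  bound : ∀ (n : ℕ) (t : ℝ≥0∞), t ≠ 0 → t ≠ ∞ →
    μ {ω | 2 * t < R n ω} ≤ 4 * n * ∫⁻ ω, minSq (Y ω / t) ∂μ

/-- The dyadic level `2 ^ (r / p)`. -/
noncomputable def level (p : ℝ) (r : ℤ) : ℝ≥0∞ := ((2 : ℝ≥0∞) ^ r) ^ (1 / p)

theorem two_zpow_ne_zero (r : ℤ) : (2 : ℝ≥0∞) ^ r ≠ 0 :=
  (ENNReal.zpow_pos (by norm_num) (by norm_num) r).ne'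

theorem two_zpow_ne_top (r : ℤ) : (2 : ℝ≥0∞) ^ r ≠ ∞ :=
  (ENNReal.zpow_lt_top (by norm_num) (by norm_num) r).ne

theorem level_ne_zero {p : ℝ} (hp : 0 < p) (r : ℤ) : level p r ≠ 0 := by
  simp [level, hp, hp.le, two_zpow_ne_zero]

theorem level_ne_top {p : ℝ} (hp : 0 < p) (r : ℤ) : level p r ≠ ∞ :=
  ENNReal.rpow_ne_top_of_nonneg (by positivity) (two_zpow_ne_top r)

/-- A discrete layer-cake bound in which one term suffices: the `r` with `2^r < (x/2)^p ≤ 2^(r+1)`.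
-/
theorem rpow_le_tsum_indicator {p : ℝ} (hp : 0 < p) {x : ℝ≥0∞} (hx : x ≠ ∞) :
    x ^ p ≤ ∑' r : ℤ, 2 ^ p * 2 * 2 ^ r * (Set.Ioi (2 * level p r)).indicator 1 x := by
  rcases eq_or_ne x 0 with rfl | hx0
  · simp [hp]
  have h2 : x / 2 ≠ ∞ := by finiteness
  have h0 : (x / 2) ^ p ≠ 0 := by simp [hx0, hp.le]
  obtain ⟨r, hr1, hr2⟩ := ENNReal.exists_mem_Ioc_zpow (y := 2) h0
      (by finiteness) (by norm_num) (by norm_num)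
  have hlev : 2 * level p r < x := by
    have : level p r < x / 2 := by
      rw [level, one_div, ENNReal.rpow_inv_lt_iff hp]; exact hr1
    rw [mul_comm]
    exact (ENNReal.lt_div_iff_mul_lt (by simp) (by simp)).1 this
  refine le_trans ?_ (ENNReal.le_tsum r)
  rw [Set.indicator_of_mem (by exact hlev), Pi.one_apply, mul_one]
  have hx2 : x = 2 * (x / 2) := (ENNReal.mul_div_cancel (by norm_num) (by norm_num)).symm
  calc x ^ p = 2 ^ p * (x / 2) ^ p := by
        rw [← ENNReal.mul_rpow_of_nonneg _ _ hp.le, ← hx2]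
    _ ≤ 2 ^ p * 2 ^ (r + 1) := by gcongr
    _ = 2 ^ p * 2 * 2 ^ r := by
        rw [ENNReal.zpow_add (by norm_num) (by norm_num), zpow_one]; ring

section

variable {mΩ : MeasurableSpace Ω} {μ : Measure Ω} {R : ℕ → Ω → ℝ≥0∞} {Y : Ω → ℝ≥0∞} {p : ℝ}

theorem WeakBound.lintegral_rpow_le_tsum (h : WeakBound μ R Y) (hp : 0 < p) (n : ℕ) :
    ∫⁻ ω, R n ω ^ p ∂μ ≤ ∑' r : ℤ, 2 ^ p * 2 * 2 ^ r * μ {ω | 2 * level p r < R n ω} := by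
  have hm : ∀ r : ℤ, MeasurableSet {ω | 2 * level p r < R n ω} := fun r =>
    measurableSet_lt measurable_const (h.measurable n)
  calc ∫⁻ ω, R n ω ^ p ∂μ
      ≤ ∫⁻ ω, ∑' r : ℤ, 2 ^ p * 2 * 2 ^ r *
          ({ω | 2 * level p r < R n ω} : Set Ω).indicator (fun _ => 1) ω ∂μ :=
        lintegral_mono fun ω => rpow_le_tsum_indicator hp (h.ne_top n ω)
    _ = _ := by
        rw [lintegral_tsum fun r => ((measurable_const.indicator (hm r)).const_mul _).aemeasurable]
        refine tsum_congr fun r => ?_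
        rw [lintegral_const_mul _ (measurable_const.indicator (hm r)),
          lintegral_indicator_const (hm r), one_mul]

theorem lintegral_tsum_minSq_le {C : ℝ≥0∞} 
    (hC : ∀ y : ℝ≥0∞, ∑' r : ℤ, (2 : ℝ≥0∞) ^ r * minSq (y / (2 ^ r) ^ (1 / p)) ≤ C * y ^ p)
    (hY : Measurable Y) :
    ∑' r : ℤ, (2 : ℝ≥0∞) ^ r * ∫⁻ ω, minSq (Y ω / level p r) ∂μ ≤ C * ∫⁻ ω, Y ω ^ p ∂μ := by
  have hm : ∀ r : ℤ, Measurable fun ω => minSq (Y ω / level p r) := fun r =>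
    measurable_minSq.comp (hY.div_const _)
  calc ∑' r : ℤ, (2 : ℝ≥0∞) ^ r * ∫⁻ ω, minSq (Y ω / level p r) ∂μ
      = ∫⁻ ω, ∑' r : ℤ, (2 : ℝ≥0∞) ^ r * minSq (Y ω / level p r) ∂μ := by
        rw [lintegral_tsum fun r => ((hm r).const_mul _).aemeasurable]
        exact tsum_congr fun r => (lintegral_const_mul _ (hm r)).symm
    _ ≤ ∫⁻ ω, C * Y ω ^ p ∂μ := lintegral_mono fun ω => hC _
    _ = _ := lintegral_const_mul _ (hY.pow_const p)

/-- Dominated convergence for the counting measure. -/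
theorem ENNReal_tendsto_tsum_zero {ι : Type*} [Countable ι] {F : ℕ → ι → ℝ≥0∞} {G : ι → ℝ≥0∞}
    (hFG : ∀ n i, F n i ≤ G i) (hG : ∑' i, G i ≠ ∞)
    (hF : ∀ i, Tendsto (fun n => F n i) atTop (𝓝 0)) :
    Tendsto (fun n => ∑' i, F n i) atTop (𝓝 0) := by
  let _ : MeasurableSpace ι := ⊤
  have := tendsto_lintegral_of_dominated_convergence (μ := Measure.count) (F := F)
    (f := fun _ => 0) G (fun n => measurable_from_top) (fun n => ae_of_all _ (hFG n))
    (by rwa [lintegral_count]) (ae_of_all _ hF)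
  simpa only [lintegral_count, lintegral_zero] using this

theorem exists_weakBound_lintegral_rpow_le (hp1 : 1 < p) (hp2 : p < 2) :
    ∃ C : ℝ≥0∞, C ≠ ∞ ∧ ∀ {R : ℕ → Ω → ℝ≥0∞} {Y : Ω → ℝ≥0∞}, WeakBound μ R Y → ∀ n : ℕ,
      ∫⁻ ω, R n ω ^ p ∂μ ≤ C * n * ∫⁻ ω, Y ω ^ p ∂μ := by
  obtain ⟨C, -, hCt, hC⟩ := exists_tsum_dyadic_minSq_le hp1 hp2
  have hp0 : 0 < p := by linarith
  refine ⟨2 ^ p * 2 * 4 * C, by finiteness, fun {R Y} h n => ?_⟩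
  calc ∫⁻ ω, R n ω ^ p ∂μ
      ≤ ∑' r : ℤ, 2 ^ p * 2 * 2 ^ r * μ {ω | 2 * level p r < R n ω} :=
        h.lintegral_rpow_le_tsum hp0 n
    _ ≤ ∑' r : ℤ, 2 ^ p * 2 * 4 * n * (2 ^ r * ∫⁻ ω, minSq (Y ω / level p r) ∂μ) := by
        refine ENNReal.tsum_le_tsum fun r => ?_
        refine (mul_le_mul_right (h.bound n _ (level_ne_zero hp0 r) (level_ne_top hp0 r)) _).trans
          (le_of_eq (by ring))
    _ ≤ 2 ^ p * 2 * 4 * n * (C * ∫⁻ ω, Y ω ^ p ∂μ) := by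
        rw [ENNReal.tsum_mul_left]
        gcongr
        exact lintegral_tsum_minSq_le hC h.measurable_bound
    _ = _ := by ring

/-- Each dyadic level contributes at most a constant over `n`, since a probability is at most `1`,
while the weak bound dominates all levels by a summable sequence independent of `n`. -/
theorem WeakBound.tendsto_lintegral_rpow [IsProbabilityMeasure μ] (h : WeakBound μ R Y)
    (hp1 : 1 < p) (hp2 : p < 2) (hY : ∫⁻ ω, Y ω ^ p ∂μ ≠ ∞) :
    Tendsto (fun n : ℕ => (∫⁻ ω, R n ω ^ p ∂μ) / n) atTop (𝓝 0) := by
  obtain ⟨C, -, hCt, hC⟩ := exists_tsum_dyadic_minSq_le hp1 hp2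
  have hp0 : 0 < p := by linarith
  set F : ℕ → ℤ → ℝ≥0∞ := fun n r =>
    2 ^ p * 2 * 2 ^ r * (min 1 (n * (4 * ∫⁻ ω, minSq (Y ω / level p r) ∂μ)) / n) with hF
  have key : Tendsto (fun n => ∑' r, F n r) atTop (𝓝 0) := by
    refine ENNReal_tendsto_tsum_zero
      (G := fun r => 2 ^ p * 2 * 4 * (2 ^ r * ∫⁻ ω, minSq (Y ω / level p r) ∂μ)) ?_ ?_ ?_
    · intro n r
      have : min 1 (n * (4 * ∫⁻ ω, minSq (Y ω / level p r) ∂μ)) / n ≤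
          4 * ∫⁻ ω, minSq (Y ω / level p r) ∂μ :=
        ENNReal.div_le_of_le_mul' (min_le_right _ _)
      exact (mul_le_mul_right this _).trans (le_of_eq (by ring))
    · rw [ENNReal.tsum_mul_left]
      refine ENNReal.mul_ne_top
          (by finiteness) (ne_top_of_le_ne_top ?_ (lintegral_tsum_minSq_le hC h.measurable_bound))
      finiteness
    · intro r
      have hr := two_zpow_ne_top r
      have h1 : Tendsto (fun n : ℕ => 2 ^ p * 2 * 2 ^ r * (n : ℝ≥0∞)⁻¹) atTop (𝓝
          (2 ^ p * 2 * 2 ^ r * 0)) :=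
        ENNReal.Tendsto.const_mul ENNReal.tendsto_inv_nat_nhds_zero (Or.inr (by finiteness))
      rw [mul_zero] at h1
      refine tendsto_of_tendsto_of_tendsto_of_le_of_le tendsto_const_nhds h1 (fun _ =>
          zero_le) fun n => ?_
      refine mul_le_mul_right ?_ _
      rw [← one_div]
      exact ENNReal.div_le_div_right (min_le_left _ _) _
  refine tendsto_of_tendsto_of_tendsto_of_le_of_le tendsto_const_nhds key (fun _ =>
      zero_le) fun n => ?_
  calc (∫⁻ ω, R n ω ^ p ∂μ) / n
      ≤ (∑' r : ℤ, 2 ^ p * 2 * 2 ^ r * μ {ω | 2 * level p r < R n ω}) / n :=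
        ENNReal.div_le_div_right (h.lintegral_rpow_le_tsum hp0 n) _
    _ ≤ (∑' r : ℤ, 2 ^ p * 2 * 2 ^ r * min 1 (n * (4 * ∫⁻ ω, minSq (Y ω / level p r) ∂μ))) / n := by
        refine ENNReal.div_le_div_right (ENNReal.tsum_le_tsum fun r => mul_le_mul_right
            (le_min prob_le_one ?_) _) _
        exact (h.bound n _ (level_ne_zero hp0 r) (level_ne_top hp0 r)).trans (le_of_eq (by ring))
    _ = ∑' r, F n r := by
        simp only [hF, div_eq_mul_inv, ← ENNReal.tsum_mul_right, mul_assoc]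

theorem level_le_rpow (hp : 0 < p) {n r : ℕ} (h : 2 ^ r ≤ n) : level p r ≤ (n : ℝ≥0∞) ^ (1 / p) :=
    by
  refine ENNReal.rpow_le_rpow ?_ (by positivity)
  rw [zpow_natCast]
  exact_mod_cast h

/-- The process is read at the right end `2^(r+1)` of the dyadic block and compared with the level
of its left end, which turns the constant `4` into `8`. -/
theorem WeakBound.measure_dyadic_le (h : WeakBound μ R Y) (hp : 0 < p) {t : ℝ≥0∞} (ht : t ≠ 0)
    (ht' : t ≠ ∞) (r : ℕ) :
    μ {ω | 2 * (t * level p r) < R (2 ^ (r + 1)) ω} ≤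
      8 * ((2 : ℝ≥0∞) ^ (r : ℤ) * ∫⁻ ω, minSq (Y ω / t / level p r) ∂μ) := by
  have hl := level_ne_zero hp r
  have hl' := level_ne_top hp r
  refine (h.bound _ _ (mul_ne_zero ht hl) (ENNReal.mul_ne_top ht' hl')).trans (le_of_eq ?_)
  have : ∀ ω, Y ω / (t * level p r) = Y ω / t / level p r := fun ω => by
    rw [div_eq_mul_inv, ENNReal.mul_inv (Or.inl ht) (Or.inl ht'), ← mul_assoc, div_eq_mul_inv,
        div_eq_mul_inv]
  simp only [this]
  push_cast
  rw [zpow_natCast]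
  ring

theorem WeakBound.tsum_measure_dyadic_le (h : WeakBound μ R Y) (hp : 0 < p) {C : ℝ≥0∞} 
    (hC : ∀ y : ℝ≥0∞, ∑' r : ℤ, (2 : ℝ≥0∞) ^ r * minSq (y / (2 ^ r) ^ (1 / p)) ≤ C * y ^ p)
    {t : ℝ≥0∞} (ht : t ≠ 0) (ht' : t ≠ ∞) :
    ∑' r : ℕ, μ {ω | 2 * (t * level p r) < R (2 ^ (r + 1)) ω} ≤
      8 * C * (∫⁻ ω, Y ω ^ p ∂μ) / t ^ p := by
  calc ∑' r : ℕ, μ {ω | 2 * (t * level p r) < R (2 ^ (r + 1)) ω}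
      ≤ ∑' r : ℕ, 8 * ((2 : ℝ≥0∞) ^ (r : ℤ) * ∫⁻ ω, minSq (Y ω / t / level p r) ∂μ) :=
        ENNReal.tsum_le_tsum fun r => h.measure_dyadic_le hp ht ht' r
    _ ≤ ∑' r : ℤ, 8 * ((2 : ℝ≥0∞) ^ r * ∫⁻ ω, minSq (Y ω / t / level p r) ∂μ) :=
        ENNReal.tsum_comp_le_tsum_of_injective (f := ((↑) : ℕ → ℤ)) Nat.cast_injective
          (fun r : ℤ => 8 * ((2 : ℝ≥0∞) ^ r * ∫⁻ ω, minSq (Y ω / t / level p r) ∂μ))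
    _ ≤ 8 * (C * ∫⁻ ω, (Y ω / t) ^ p ∂μ) := by
        rw [ENNReal.tsum_mul_left]
        gcongr
        exact lintegral_tsum_minSq_le hC (h.measurable_bound.div_const t)
    _ = _ := by
        have e : ∀ ω, (Y ω / t) ^ p = Y ω ^ p * (t ^ p)⁻¹ := fun ω => by
          rw [ENNReal.div_rpow_of_nonneg _ _ hp.le, div_eq_mul_inv]
        simp only [e]
        rw [div_eq_mul_inv, lintegral_mul_const _ (h.measurable_bound.pow_const p)]
        ring

/-- The maximal function `sup_{n ≥ 1} R n / n ^ (1 / p)`. -/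
noncomputable def maxFun (p : ℝ) (R : ℕ → Ω → ℝ≥0∞) (ω : Ω) : ℝ≥0∞ :=
  ⨆ n : ℕ, R (n + 1) ω / ((n + 1 : ℕ) : ℝ≥0∞) ^ (1 / p)

theorem WeakBound.measurable_maxFun (h : WeakBound μ R Y) : Measurable (maxFun p R) :=
  Measurable.iSup fun _ => (h.measurable _).div_const _

theorem WeakBound.le_of_dyadic (h : WeakBound μ R Y) (hp : 0 < p) {t : ℝ≥0∞} {ω : Ω} {n : ℕ}
    (hn : n ≠ 0) (hr : R (2 ^ (Nat.log 2 n + 1)) ω ≤ 2 * (t * level p (Nat.log 2 n))) :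
    R n ω / (n : ℝ≥0∞) ^ (1 / p) ≤ 2 * t := by
  refine ENNReal.div_le_of_le_mul ?_
  calc R n ω ≤ R (2 ^ (Nat.log 2 n + 1)) ω := h.mono ω (Nat.lt_pow_succ_log_self (by norm_num) n).le
    _ ≤ 2 * (t * level p (Nat.log 2 n)) := hr
    _ ≤ 2 * (t * (n : ℝ≥0∞) ^ (1 / p)) := by
        gcongr
        exact level_le_rpow hp (Nat.pow_log_le_self 2 hn)
    _ = _ := by ring

/-- By monotonicity, exceeding `2t` at time `n` forces an exceedance at the end of the dyadic block
of `n`; a union bound over blocks gives a weak `L^p` estimate. -/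
theorem WeakBound.measure_maxFun_le (h : WeakBound μ R Y) (hp : 0 < p) {C : ℝ≥0∞} 
    (hC : ∀ y : ℝ≥0∞, ∑' r : ℤ, (2 : ℝ≥0∞) ^ r * minSq (y / (2 ^ r) ^ (1 / p)) ≤ C * y ^ p)
    {t : ℝ≥0∞} (ht : t ≠ 0) (ht' : t ≠ ∞) :
    μ {ω | 2 * t < maxFun p R ω} ≤ 8 * C * (∫⁻ ω, Y ω ^ p ∂μ) / t ^ p := by
  refine le_trans ?_ (h.tsum_measure_dyadic_le hp hC ht ht')
  refine le_trans (measure_mono fun ω hω => ?_) (measure_iUnion_le _)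
  obtain ⟨n, hn⟩ := lt_iSup_iff.1 (show 2 * t < ⨆ n : ℕ, _ from hω)
  by_contra hcon
  simp only [Set.mem_iUnion, Set.mem_ofPred_eq, not_exists, not_lt] at hcon
  exact absurd (h.le_of_dyadic hp n.succ_ne_zero (hcon _)) (not_le.2 hn)

/-- Borel–Cantelli along dyadic blocks, for each of the thresholds `1/(k+1)`. -/
theorem WeakBound.ae_tendsto (h : WeakBound μ R Y) (hp1 : 1 < p) (hp2 : p < 2)
    (hY : ∫⁻ ω, Y ω ^ p ∂μ ≠ ∞) :
    ∀ᵐ ω ∂μ, Tendsto (fun n : ℕ => R n ω / (n : ℝ≥0∞) ^ (1 / p)) atTop (𝓝 0) := by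
  obtain ⟨C, -, hCt, hC⟩ := exists_tsum_dyadic_minSq_le hp1 hp2
  have hp0 : 0 < p := by linarith
  have hk : ∀ k : ℕ, ∀ᵐ ω ∂μ, ∀ᶠ n : ℕ in atTop,
      R n ω / (n : ℝ≥0∞) ^ (1 / p) ≤ 2 * ((k + 1 : ℕ) : ℝ≥0∞)⁻¹ := by
    intro k
    have ht : ((k + 1 : ℕ) : ℝ≥0∞)⁻¹ ≠ 0 := by simp
    have ht' : ((k + 1 : ℕ) : ℝ≥0∞)⁻¹ ≠ ∞ := by simp
    have hsum := ne_top_of_le_ne_top (by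
      refine ENNReal.div_ne_top (by finiteness) ?_
      simp) (h.tsum_measure_dyadic_le hp0 hC ht ht')
    filter_upwards [ae_eventually_notMem hsum] with ω hω
    have hlog : Tendsto (fun n : ℕ => Nat.log 2 n) atTop atTop := by
      refine tendsto_atTop_atTop.2 fun b => ⟨2 ^ b, fun n hn => ?_⟩
      exact Nat.le_log_of_pow_le (by norm_num) hn
    filter_upwards [hlog.eventually hω, eventually_ne_atTop 0] with n hn hn0
    exact h.le_of_dyadic hp0 hn0 (not_lt.1 hn)
  filter_upwards [ae_all_iff.2 hk] with ω hω
  have hlim : Tendsto (fun k : ℕ => 2 * ((k + 1 : ℕ) : ℝ≥0∞)⁻¹) atTop (𝓝 0) := by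
    have := ENNReal.Tendsto.const_mul (a := 2)
      (ENNReal.tendsto_inv_nat_nhds_zero.comp (tendsto_add_atTop_nat 1)) (Or.inr (by norm_num))
    simpa using this
  rw [ENNReal.tendsto_nhds_zero]
  intro ε hε
  obtain ⟨k, hk⟩ := ((ENNReal.tendsto_nhds_zero.1 hlim) ε hε).exists
  exact (hω k).mono fun n hn => hn.trans hk

/-- Layer cake above the floor `2L`: for finite `x > 2L` the single `j` with `2^j < x/(2L) ≤
2^(j+1)` suffices, and for `x = ∞` the series diverges. -/
theorem le_add_tsum_indicator {L x : ℝ≥0∞} (hL : L ≠ 0) (hL' : L ≠ ∞) :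
    x ≤ 2 * L + ∑' j : ℕ, 4 * L * 2 ^ j * (Set.Ioi (2 * (L * 2 ^ j))).indicator 1 x := by
  rcases le_or_gt x (2 * L) with h | h
  · exact h.trans le_self_add
  rcases eq_or_ne x ∞ with rfl | hx
  · have hlt : ∀ j : ℕ, 2 * (L * 2 ^ j) < ∞ := fun j => by finiteness
    have : ∑' j : ℕ, 4 * L * 2 ^ j * (Set.Ioi (2 * (L * 2 ^ j))).indicator (1 : ℝ≥0∞ → ℝ≥0∞) ∞ =
        ∞ := by
      have hc := ENNReal.tsum_const_eq_top_of_ne_zero (α := ℕ)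
        (mul_ne_zero (by norm_num : (4 : ℝ≥0∞) ≠ 0) hL)
      refine top_le_iff.1 (hc.ge.trans (ENNReal.tsum_le_tsum fun j => ?_))
      rw [Set.indicator_of_mem (by exact hlt j), Pi.one_apply, mul_one]
      exact le_mul_of_one_le_right zero_le (one_le_pow₀ (by norm_num))
    rw [this]; simp
  · have hy0 : x / (2 * L) ≠ 0 := by
      simp [(pos_of_gt h).ne', hL', ENNReal.mul_eq_top]
    have hyt : x / (2 * L) ≠ ∞ := ENNReal.div_ne_top hx (mul_ne_zero (by norm_num) hL)
    obtain ⟨j, hj1, hj2⟩ := ENNReal.exists_mem_Ioc_zpow (y := 2) hy0 hyt (by norm_num) (by norm_num)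
    have h1 : 1 < x / (2 * L) := by
      rw [ENNReal.lt_div_iff_mul_lt
          (by simp [hL]) (by simp [ENNReal.mul_eq_top, hL']), one_mul]; exact h
    have hj0 : 0 ≤ j := by
      by_contra hneg
      have : (2 : ℝ≥0∞) ^ (j + 1) ≤ 2 ^ (0 : ℤ) := ENNReal.zpow_le_of_le (by norm_num) (by omega)
      rw [zpow_zero] at this
      exact absurd (h1.trans_le (hj2.trans this)) (lt_irrefl _)
    lift j to ℕ using hj0
    refine le_trans ?_ (le_add_left (ENNReal.le_tsum j))
    have h2L : 2 * L ≠ 0 := mul_ne_zero (by norm_num) hL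
    have h2L' : 2 * L ≠ ∞ := by finiteness
    rw [ENNReal.lt_div_iff_mul_lt (Or.inl h2L) (Or.inl h2L'), zpow_natCast] at hj1
    rw [Set.indicator_of_mem
        (by simp only [Set.mem_Ioi]; convert hj1 using 1; ring), Pi.one_apply, mul_one]
    rw [ENNReal.div_le_iff h2L h2L'] at hj2
    refine hj2.trans (le_of_eq ?_)
    rw [← Nat.cast_succ, zpow_natCast, pow_succ]
    ring

/-- A weak `L^p` tail with `p > 1` is integrable: cutting at `L` near `‖Y‖_p`, the levels `L 2^j`
contribute a geometric series of ratio `2^(1-p) < 1`. -/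
theorem exists_weakBound_lintegral_maxFun_le [IsProbabilityMeasure μ] (hp1 : 1 < p) (hp2 : p < 2) :
    ∃ C : ℝ≥0∞, C ≠ ∞ ∧ ∀ {R : ℕ → Ω → ℝ≥0∞} {Y : Ω → ℝ≥0∞}, WeakBound μ R Y →
      ∫⁻ ω, maxFun p R ω ∂μ ≤ C * (∫⁻ ω, Y ω ^ p ∂μ) ^ (1 / p) := by
  obtain ⟨C, -, hCt, hC⟩ := exists_tsum_dyadic_minSq_le hp1 hp2
  have hp0 : 0 < p := by linarith
  set ρ : ℝ≥0∞ := 2 ^ (1 - p) with hρ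
  have hρ1 : ρ < 1 := ENNReal.rpow_lt_one_of_one_lt_of_neg (by norm_num) (by linarith)
  set K : ℝ≥0∞ := 2 + 32 * C * (1 - ρ)⁻¹ with hK
  have hKt : K ≠ ∞ := by
    have : (1 - ρ)⁻¹ ≠ ∞ := ENNReal.inv_ne_top.2 (tsub_pos_of_lt hρ1).ne'
    finiteness
  have hK0 : K ≠ 0 := by simp [hK]
  refine ⟨K, hKt, fun {R Y} h => ?_⟩
  -- Taking `L` strictly above `‖Y‖_p` keeps it nonzero even when `Y` vanishes; the bound at `‖Y‖_p`
  -- itself follows by density.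
  have key : ∀ L : ℝ≥0∞, (∫⁻ ω, Y ω ^ p ∂μ) ^ (1 / p) < L → ∫⁻ ω, maxFun p R ω ∂μ ≤ K * L := by
    intro L hL
    have hL0 : L ≠ 0 := hL.ne_bot
    rcases eq_or_ne L ∞ with rfl | hLt
    · rw [ENNReal.mul_top hK0]; exact le_top
    have hYL : ∫⁻ ω, Y ω ^ p ∂μ ≤ L ^ p := by
      rw [one_div, ENNReal.rpow_inv_lt_iff hp0] at hL
      exact hL.le
    have hm : ∀ j : ℕ, MeasurableSet {ω | 2 * (L * 2 ^ j) < maxFun p R ω} := fun j =>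
      measurableSet_lt measurable_const h.measurable_maxFun
    calc ∫⁻ ω, maxFun p R ω ∂μ
        ≤ ∫⁻ ω, (2 * L + ∑' j : ℕ, 4 * L * 2 ^ j *
            ({ω | 2 * (L * 2 ^ j) < maxFun p R ω} : Set Ω).indicator (fun _ => 1) ω) ∂μ :=
          lintegral_mono fun ω => le_add_tsum_indicator hL0 hLt
      _ = 2 * L + ∑' j : ℕ, 4 * L * 2 ^ j * μ {ω | 2 * (L * 2 ^ j) < maxFun p R ω} := by
          rw [lintegral_add_left measurable_const, lintegral_const, measure_univ, mul_one,
            lintegral_tsum fun j => ((measurable_const.indicator (hm j)).const_mul _).aemeasurable]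
          congr 1
          refine tsum_congr fun j => ?_
          rw [lintegral_const_mul _ (measurable_const.indicator (hm j)),
            lintegral_indicator_const (hm j), one_mul]
      _ ≤ 2 * L + ∑' j : ℕ, 32 * C * L * ρ ^ j := by
          refine add_le_add le_rfl (ENNReal.tsum_le_tsum fun j => ?_)
          have hpos : L * 2 ^ j ≠ 0 := mul_ne_zero hL0 (by simp)
          have h2 : (2 : ℝ≥0∞) ^ j * ((2 ^ j) ^ p)⁻¹ = ρ ^ j := by
            rw [hρ, ← ENNReal.rpow_neg, ← ENNReal.rpow_natCast, ← ENNReal.rpow_mul,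
                ← ENNReal.rpow_natCast,
              ← ENNReal.rpow_mul, ← ENNReal.rpow_add _ _ (by norm_num) (by norm_num)]
            congr 1; ring
          calc 4 * L * 2 ^ j * μ {ω | 2 * (L * 2 ^ j) < maxFun p R ω}
              ≤ 4 * L * 2 ^ j * (8 * C * L ^ p / (L * 2 ^ j) ^ p) := by
                gcongr
                refine (h.measure_maxFun_le hp0 hC hpos (by finiteness)).trans ?_
                gcongr
            _ = 32 * C * L * (2 ^ j * ((2 ^ j) ^ p)⁻¹) * (L ^ p * (L ^ p)⁻¹) := by
                rw [ENNReal.mul_rpow_of_nonneg _ _ hp0.le, div_eq_mul_inv,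
                  ENNReal.mul_inv (Or.inl (by simp [hL0, hp0.le])) (Or.inl (by finiteness))]
                ring
            _ = 32 * C * L * ρ ^ j := by
                rw [ENNReal.mul_inv_cancel (by simp [hL0, hp0.le]) (by finiteness), mul_one, h2]
      _ = K * L := by
          rw [ENNReal.tsum_mul_left, ENNReal.tsum_geometric, hK]
          ring
  rw [mul_comm, ← ENNReal.div_le_iff hK0 hKt]
  refine le_of_forall_gt_imp_ge_of_dense fun L hL => ?_
  rw [ENNReal.div_le_iff hK0 hKt, mul_comm]
  exact key L hL

end

/-! ### Negligible processes and their series -/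

section

variable {mΩ : MeasurableSpace Ω} {μ : Measure Ω} {p : ℝ}

/-- The process `Z` is `o (n ^ (1 / p))` both almost surely and in `L^p`. -/
structure Negligible (μ : Measure Ω) (p : ℝ) (Z : ℕ → Ω → ℝ≥0∞) : Prop where
  aemeasurable : ∀ n, AEMeasurable (Z n) μ
  ae_tendsto : ∀ᵐ ω ∂μ, Tendsto (fun n : ℕ => Z n ω / (n : ℝ≥0∞) ^ (1 / p)) atTop (𝓝 0)
  tendsto_norm : Tendsto (fun n : ℕ => (∫⁻ ω, Z n ω ^ p ∂μ) ^ (1 / p) / (n : ℝ≥0∞) ^ (1 / p))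
    atTop (𝓝 0)

theorem Negligible.add (hp : 1 ≤ p) {Z Z' : ℕ → Ω → ℝ≥0∞} (h : Negligible μ p Z)
    (h' : Negligible μ p Z') : Negligible μ p (fun n ω => Z n ω + Z' n ω) where
  aemeasurable n := (h.aemeasurable n).add (h'.aemeasurable n)
  ae_tendsto := by
    filter_upwards [h.ae_tendsto, h'.ae_tendsto] with ω h1 h2
    simpa [ENNReal.add_div] using h1.add h2
  tendsto_norm := by
    have := h.tendsto_norm.add h'.tendsto_norm
    rw [add_zero] at this
    refine tendsto_of_tendsto_of_tendsto_of_le_of_le tendsto_const_nhds this (fun _ =>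
        zero_le) fun n => ?_
    simp only [← ENNReal.add_div]
    exact ENNReal.div_le_div_right
      (ENNReal.lintegral_Lp_add_le (h.aemeasurable n) (h'.aemeasurable n) hp) _

/-- Minkowski's inequality for finite sums, passed to the limit by monotone convergence. -/
theorem lintegral_Lp_tsum_le (hp : 1 ≤ p) {f : ℕ → Ω → ℝ≥0∞} (hf : ∀ i, AEMeasurable (f i) μ) :
    (∫⁻ ω, (∑' i, f i ω) ^ p ∂μ) ^ (1 / p) ≤ ∑' i, (∫⁻ ω, f i ω ^ p ∂μ) ^ (1 / p) := by
  have hp0 : 0 < p := by linarith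
  have hfin : ∀ n : ℕ, (∫⁻ ω, (∑ i ∈ Finset.range n, f i ω) ^ p ∂μ) ^ (1 / p) ≤
      ∑ i ∈ Finset.range n, (∫⁻ ω, f i ω ^ p ∂μ) ^ (1 / p) := by
    intro n
    induction n with
    | zero => simp [hp0]
    | succ n ih =>
      simp only [Finset.sum_range_succ]
      refine (ENNReal.lintegral_Lp_add_le (Finset.aemeasurable_fun_sum _ fun i _ => hf i)
          (hf n) hp).trans ?_
      gcongr
  have hlim : ∀ ω, Tendsto (fun n => (∑ i ∈ Finset.range n, f i ω) ^ p) atTop (𝓝 ((∑' i,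
      f i ω) ^ p)) :=
    fun ω => (ENNReal.continuous_rpow_const.tendsto _).comp (ENNReal.tendsto_nat_tsum _)
  have hmono := lintegral_tendsto_of_tendsto_of_monotone
    (f := fun n ω => (∑ i ∈ Finset.range n, f i ω) ^ p) (μ := μ)
    (fun n => (Finset.aemeasurable_fun_sum _ fun i _ => hf i).pow_const p)
    (ae_of_all _ fun ω n m hnm => by
      exact ENNReal.rpow_le_rpow (Finset.sum_le_sum_of_subset (Finset.range_mono hnm)) hp0.le)
    (ae_of_all _ hlim)
  refine le_of_tendsto' ((ENNReal.continuous_rpow_const.tendsto _).comp hmono) fun n => ?_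
  exact (hfin n).trans (ENNReal.sum_le_tsum _)

theorem le_maxFun_mul (hp : 0 < p) {R : ℕ → Ω → ℝ≥0∞} {ω : Ω} (h0 : R 0 ω = 0) {q : ℕ} (hq : q ≠ 0)
    (n : ℕ) : R (n / q) ω / (n : ℝ≥0∞) ^ (1 / p) ≤ maxFun p R ω / (q : ℝ≥0∞) ^ (1 / p) := by
  rcases Nat.eq_zero_or_eq_succ_pred (n / q) with h | h
  · simp [h, h0]
  set m := (n / q).pred with hm
  have h1 : R (n / q) ω ≤ maxFun p R ω * ((m + 1 : ℕ) : ℝ≥0∞) ^ (1 / p) := by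
    rw [← ENNReal.div_le_iff (by simp) (by finiteness), h]
    exact le_iSup (fun n : ℕ => R (n + 1) ω / ((n + 1 : ℕ) : ℝ≥0∞) ^ (1 / p)) m
  have h2 : ((m + 1 : ℕ) : ℝ≥0∞) * q ≤ n := by
    have := Nat.div_mul_le_self n q
    rw [h] at this
    exact_mod_cast this
  have hn : n ≠ 0 := by
    rintro rfl
    simp at h
  have hq' : (q : ℝ≥0∞) ≠ 0 := by simpa using hq
  have hn' : (n : ℝ≥0∞) ≠ 0 := by simpa using hn
  rw [ENNReal.div_le_iff (by simp [hn']) (by finiteness), mul_comm, ← mul_div_assoc,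
    ENNReal.le_div_iff_mul_le (Or.inl (by simp [hq'])) (Or.inl (by finiteness))]
  calc R (n / q) ω * (q : ℝ≥0∞) ^ (1 / p)
      ≤ maxFun p R ω * ((m + 1 : ℕ) : ℝ≥0∞) ^ (1 / p) * (q : ℝ≥0∞) ^ (1 / p) := by gcongr
    _ = maxFun p R ω * (((m + 1 : ℕ) : ℝ≥0∞) * q) ^ (1 / p) := by
        rw [ENNReal.mul_rpow_of_nonneg _ _ (by positivity), mul_assoc]
    _ ≤ maxFun p R ω * (n : ℝ≥0∞) ^ (1 / p) := by gcongr
    _ = _ := mul_comm _ _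

theorem tendsto_comp_div (hp : 0 < p) {x : ℕ → ℝ≥0∞} {q : ℕ} (hq : q ≠ 0)
    (h : Tendsto (fun n : ℕ => x n / (n : ℝ≥0∞) ^ (1 / p)) atTop (𝓝 0)) :
    Tendsto (fun n : ℕ => x (n / q) / (n : ℝ≥0∞) ^ (1 / p)) atTop (𝓝 0) := by
  refine tendsto_of_tendsto_of_tendsto_of_le_of_le tendsto_const_nhds
    (h.comp (Nat.tendsto_div_const_atTop hq)) (fun _ => zero_le) fun n => ?_
  refine ENNReal.div_le_div_left (ENNReal.rpow_le_rpow ?_ (by positivity)) _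
  exact_mod_cast Nat.div_le_self n q

/-- Every term is negligible, so only a domination uniform in `n` is needed. Pointwise it is `maxFun
/ q_i^(1/p)`, whose sum is integrable and hence almost surely finite; in norm it is `C^(1/p) ‖Y_i‖_p
/ q_i^(1/p)`. The gain `q_i^(-1/p)` comes from running the `i`-th process only up to time `n / q_i`.
-/
theorem negligible_tsum [IsProbabilityMeasure μ] (hp1 : 1 < p) (hp2 : p < 2)
    {R : ℕ → ℕ → Ω → ℝ≥0∞} {Y : ℕ → Ω → ℝ≥0∞} {q : ℕ → ℕ} (hq : ∀ i, q i ≠ 0)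
    (hW : ∀ i, WeakBound μ (R i) (Y i))
    (hsum : ∑' i, (∫⁻ ω, Y i ω ^ p ∂μ) ^ (1 / p) / (q i : ℝ≥0∞) ^ (1 / p) ≠ ∞) :
    Negligible μ p (fun n ω => ∑' i, R i (n / q i) ω) := by
  have hp0 : 0 < p := by linarith
  have hYt : ∀ i, ∫⁻ ω, Y i ω ^ p ∂μ ≠ ∞ := by
    intro i hi
    have h1 := ENNReal.ne_top_of_tsum_ne_top hsum i
    rw [hi, ENNReal.top_rpow_of_pos
        (by positivity), ENNReal.top_div_of_ne_top (by finiteness)] at h1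
    exact h1 rfl
  refine ⟨fun n => AEMeasurable.tsum fun i => ((hW i).measurable _).aemeasurable, ?_, ?_⟩
  · obtain ⟨C, hCt, hC⟩ := exists_weakBound_lintegral_maxFun_le (μ := μ) hp1 hp2
    have hint : ∫⁻ ω, ∑' i, maxFun p (R i) ω / (q i : ℝ≥0∞) ^ (1 / p) ∂μ ≠ ∞ := by
      rw [lintegral_tsum fun i => ((hW i).measurable_maxFun.div_const _).aemeasurable]
      refine ne_top_of_le_ne_top (ENNReal.mul_ne_top hCt hsum) ?_
      rw [← ENNReal.tsum_mul_left]
      refine ENNReal.tsum_le_tsum fun i => ?_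
      simp only [div_eq_mul_inv]
      rw [lintegral_mul_const _ (hW i).measurable_maxFun, ← mul_assoc]
      have := hC (hW i)
      simp only [div_eq_mul_inv] at this
      gcongr
    have hfin := ae_lt_top (Measurable.tsum fun i => (hW i).measurable_maxFun.div_const _) hint
    filter_upwards [hfin, ae_all_iff.2 fun i => (hW i).ae_tendsto hp1 hp2 (hYt i)] with ω h1 h2
    simp only [div_eq_mul_inv _ ((_ : ℝ≥0∞) ^ (1 / p)), ← ENNReal.tsum_mul_right]
    simp only [← div_eq_mul_inv]
    exact ENNReal_tendsto_tsum_zero (fun n i => le_maxFun_mul hp0 ((hW i).zero ω) (hq i) n) h1.ne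
      fun i => tendsto_comp_div hp0 (hq i) (h2 i)
  · obtain ⟨C, hCt, hC⟩ := exists_weakBound_lintegral_rpow_le (μ := μ) hp1 hp2
    have hCt' : C ^ (1 / p) ≠ ∞ := by finiteness
    have key : Tendsto (fun n : ℕ => ∑' i, (∫⁻ ω, R i (n / q i) ω ^ p ∂μ) ^ (1 / p) / (n : ℝ≥0∞) ^
        (1 / p))
        atTop (𝓝 0) := by
      refine ENNReal_tendsto_tsum_zero (G := fun i =>
        C ^ (1 / p) * ((∫⁻ ω, Y i ω ^ p ∂μ) ^ (1 / p) / (q i : ℝ≥0∞) ^ (1 / p))) (fun n i =>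
            ?_) ?_ fun i => ?_
      · have hR : ∫⁻ ω, R i (n / q i) ω ^ p ∂μ ≤ C * ((n / q i : ℕ) : ℝ≥0∞) * ∫⁻ ω, Y i ω ^ p ∂μ :=
            hC (hW i) _
        rcases eq_or_ne n 0 with rfl | hn
        · simp [(hW i).zero, hp0]
        have hq' : (q i : ℝ≥0∞) ≠ 0 := by simpa using hq i
        have hn' : (n : ℝ≥0∞) ≠ 0 := by simpa using hn
        have hdiv : ((n / q i : ℕ) : ℝ≥0∞) ≤ n / q i := by
          rw [ENNReal.le_div_iff_mul_le (Or.inl hq') (Or.inl (by finiteness))]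
          exact_mod_cast Nat.div_mul_le_self n (q i)
        rw [← ENNReal.div_rpow_of_nonneg _ _
            (by positivity), ← ENNReal.div_rpow_of_nonneg _ _ (by positivity),
          ← ENNReal.mul_rpow_of_nonneg _ _ (by positivity)]
        refine ENNReal.rpow_le_rpow (ENNReal.div_le_of_le_mul ?_) (by positivity)
        calc _ ≤ C * ((n / q i : ℕ) : ℝ≥0∞) * ∫⁻ ω, Y i ω ^ p ∂μ := hR
          _ ≤ C * (n / q i) * ∫⁻ ω, Y i ω ^ p ∂μ := by gcongr
          _ = _ := by simp only [div_eq_mul_inv]; ring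
      · rw [ENNReal.tsum_mul_left]
        exact ENNReal.mul_ne_top hCt' hsum
      · refine tendsto_comp_div (x := fun m => (∫⁻ ω, R i m ω ^ p ∂μ) ^ (1 / p)) hp0 (hq i) ?_
        have := ((ENNReal.continuous_rpow_const (y := 1 / p)).tendsto _).comp
          ((hW i).tendsto_lintegral_rpow hp1 hp2 (hYt i))
        rw [ENNReal.zero_rpow_of_pos (by positivity)] at this
        refine this.congr fun n => ?_
        simp only [Function.comp_apply]
        rw [ENNReal.div_rpow_of_nonneg _ _ (by positivity)]
    refine tendsto_of_tendsto_of_tendsto_of_le_of_le tendsto_const_nhds key (fun _ =>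
        zero_le) fun n => ?_
    simp only [div_eq_mul_inv _ ((_ : ℝ≥0∞) ^ (1 / p)), ENNReal.tsum_mul_right]
    refine mul_le_mul_left ?_ _
    exact lintegral_Lp_tsum_le hp1.le fun i => ((hW i).measurable _).aemeasurable

theorem WeakBound.negligible [IsProbabilityMeasure μ] (hp1 : 1 < p) (hp2 : p < 2)
    {R : ℕ → Ω → ℝ≥0∞} {Y : Ω → ℝ≥0∞} (hW : WeakBound μ R Y) (hY : ∫⁻ ω, Y ω ^ p ∂μ ≠ ∞) :
    Negligible μ p R where
  aemeasurable n := (hW.measurable n).aemeasurable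
  ae_tendsto := hW.ae_tendsto hp1 hp2 hY
  tendsto_norm := by
    have := ((ENNReal.continuous_rpow_const (y := 1 / p)).tendsto _).comp
      (hW.tendsto_lintegral_rpow hp1 hp2 hY)
    rw [ENNReal.zero_rpow_of_pos (by rw [one_div, inv_pos]; linarith)] at this
    refine this.congr fun n => ?_
    simp only [Function.comp_apply]
    rw [ENNReal.div_rpow_of_nonneg _ _ (by rw [one_div, inv_nonneg]; linarith)]

end

/-! ### The weak-type bound for Hilbert-valued martingale differences -/

theorem measurable_finset_sup {mΩ : MeasurableSpace Ω} (s : Finset ℕ) {f : ℕ → Ω → ℝ≥0∞}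
    (hf : ∀ k, Measurable (f k)) : Measurable fun ω => s.sup fun k => f k ω := by
  induction s using Finset.cons_induction with
  | empty => simp
  | cons a s ha ih =>
    simp only [Finset.sup_cons]
    exact (hf a).sup ih

/-- The running maximum of the norms of the partial sums of `D`. -/
noncomputable def maxSum [NormedAddCommGroup H] (D : ℕ → Ω → H) (n : ℕ) (ω : Ω) : ℝ≥0∞ :=
  (Finset.range (n + 1)).sup fun k => ‖∑ i ∈ Finset.range k, D i ω‖ₑ

theorem enorm_sum_le_maxSum [NormedAddCommGroup H] (D : ℕ → Ω → H) (n : ℕ) (ω : Ω) :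
    ‖∑ i ∈ Finset.range n, D i ω‖ₑ ≤ maxSum D n ω :=
  Finset.le_sup (f := fun k => ‖∑ i ∈ Finset.range k, D i ω‖ₑ) (Finset.self_mem_range_succ n)

section

variable [NormedAddCommGroup H] [InnerProductSpace ℝ H] {mΩ : MeasurableSpace Ω} {μ : Measure Ω}

theorem integrable_inner_of_memLp {f g : Ω → H} (hf : MemLp f 2 μ) (hg : MemLp g 2 μ) :
    Integrable (fun ω => inner ℝ (f ω) (g ω)) μ := by
  refine (hf.norm.integrable_mul hg.norm).mono' (hf.1.inner hg.1) (ae_of_all _ fun ω => ?_)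
  exact norm_inner_le_norm _ _

theorem ofReal_integral_norm_sq {f : Ω → H} (hf : MemLp f 2 μ) :
    ENNReal.ofReal (∫ ω, ‖f ω‖ ^ 2 ∂μ) = ∫⁻ ω, ‖f ω‖ₑ ^ 2 ∂μ := by
  rw [ofReal_integral_eq_lintegral_ofReal (hf.integrable_norm_pow (p := 2) (by norm_num))
    (ae_of_all _ fun ω => by positivity)]
  refine lintegral_congr fun ω => ?_
  rw [ENNReal.ofReal_pow (norm_nonneg _), ofReal_norm]

variable [CompleteSpace H]

theorem integral_inner_eq_zero_of_condExp [IsFiniteMeasure μ] {m : MeasurableSpace Ω} (hm : m ≤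
    mΩ) {f g : Ω → H}
    (hfm : StronglyMeasurable[m] f) (hf : MemLp f 2 μ) (hg : MemLp g 2 μ) (hgc : μ[g | m] =ᵐ[μ] 0) :
    ∫ ω, inner ℝ (f ω) (g ω) ∂μ = 0 := by
  have h := condExp_bilin_of_stronglyMeasurable_left (innerSL ℝ) hfm
    (integrable_inner_of_memLp hf hg) (hg.integrable (by norm_num))
  rw [← integral_condExp hm]
  refine integral_eq_zero_of_ae ?_
  refine h.trans ?_
  filter_upwards [hgc] with ω hω
  simp [hω]

variable [IsFiniteMeasure μ] {𝒢 : Filtration ℕ mΩ} {e : ℕ → Ω → H}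

theorem stronglyMeasurable_sum_diff (hm : ∀ k, StronglyMeasurable[𝒢 (k + 1)] (e k)) (n : ℕ) :
    StronglyMeasurable[𝒢 n] fun ω => ∑ k ∈ Finset.range n, e k ω := by
  refine Finset.stronglyMeasurable_fun_sum _ fun k hk => ?_
  exact (hm k).mono (𝒢.mono (Finset.mem_range.1 hk))

theorem memLp_sum_diff (he : ∀ k, MemLp (e k) 2 μ) (n : ℕ) :
    MemLp (fun ω => ∑ k ∈ Finset.range n, e k ω) 2 μ :=
  memLp_finsetSum _ fun k _ => he k

/-- Orthogonality of the increment to the past, localized to a past event: with the whole space it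
gives additivity of variances, with general `s` the submartingale property of the squared norm. -/
theorem setIntegral_norm_sq_sum_succ (hm : ∀ k, StronglyMeasurable[𝒢 (k + 1)] (e k))
    (he : ∀ k, MemLp (e k) 2 μ) (hc : ∀ k, μ[e k | 𝒢 k] =ᵐ[μ] 0) (n : ℕ) {s : Set Ω}
    (hs : MeasurableSet[𝒢 n] s) :
    ∫ ω in s, ‖∑ k ∈ Finset.range (n + 1), e k ω‖ ^ 2 ∂μ =
      ∫ ω in s, ‖∑ k ∈ Finset.range n, e k ω‖ ^ 2 ∂μ + ∫ ω in s, ‖e n ω‖ ^ 2 ∂μ := by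
  have hN := memLp_sum_diff he n
  have hNm := stronglyMeasurable_sum_diff hm n
  have hs' : MeasurableSet s := 𝒢.le n _ hs
  have h0 : ∫ ω in s, inner ℝ (∑ k ∈ Finset.range n, e k ω) (e n ω) ∂μ = 0 := by
    rw [← integral_inner_eq_zero_of_condExp (𝒢.le n) (hNm.indicator hs) (hN.indicator hs') (he n)
        (hc n),
      ← integral_indicator hs']
    refine integral_congr_ae (ae_of_all _ fun ω => ?_)
    by_cases hω : ω ∈ s <;> simp [hω]
  have i1 : Integrable (fun ω => ‖∑ k ∈ Finset.range n, e k ω‖ ^ 2) μ := hN.integrable_norm_pow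
      (p := 2) (by norm_num)
  have i2 : Integrable (fun ω => ‖e n ω‖ ^ 2) μ := (he n).integrable_norm_pow (p := 2) (by norm_num)
  have i3 := (integrable_inner_of_memLp hN (he n)).const_mul 2
  have : ∀ ω, ‖∑ k ∈ Finset.range (n + 1), e k ω‖ ^ 2 =
      ‖∑ k ∈ Finset.range n, e k ω‖ ^ 2 + 2 * inner ℝ (∑ k ∈ Finset.range n, e k ω) (e n ω) +
          ‖e n ω‖ ^ 2 := by
    intro ω
    rw [Finset.sum_range_succ, norm_add_sq_real]
  simp only [this]
  have a1 := integral_add (μ := μ.restrict s) (i1.add i3).integrableOn i2.integrableOn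
  have a2 := integral_add (μ := μ.restrict s) i1.integrableOn i3.integrableOn
  simp only [Pi.add_apply] at a1
  rw [a1, a2, integral_const_mul, h0]
  ring

theorem integral_norm_sq_sum (hm : ∀ k, StronglyMeasurable[𝒢 (k + 1)] (e k))
    (he : ∀ k, MemLp (e k) 2 μ) (hc : ∀ k, μ[e k | 𝒢 k] =ᵐ[μ] 0) (n : ℕ) :
    ∫ ω, ‖∑ k ∈ Finset.range n, e k ω‖ ^ 2 ∂μ = ∑ k ∈ Finset.range n, ∫ ω, ‖e k ω‖ ^ 2 ∂μ := by
  induction n with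
  | zero => simp
  | succ n ih =>
    have := setIntegral_norm_sq_sum_succ hm he hc n (MeasurableSet.univ)
    simp only [Measure.restrict_univ] at this
    rw [this, ih, Finset.sum_range_succ (fun k => ∫ ω, ‖e k ω‖ ^ 2 ∂μ)]

theorem submartingale_norm_sq_sum (hm : ∀ k, StronglyMeasurable[𝒢 (k + 1)] (e k))
    (he : ∀ k, MemLp (e k) 2 μ) (hc : ∀ k, μ[e k | 𝒢 k] =ᵐ[μ] 0) :
    Submartingale (fun n ω => ‖∑ k ∈ Finset.range n, e k ω‖ ^ 2) 𝒢 μ := by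
  refine submartingale_of_setIntegral_le_succ (fun n =>
      (stronglyMeasurable_sum_diff hm n).norm.pow 2)
    (fun n => (memLp_sum_diff he n).integrable_norm_pow (p := 2) (by norm_num)) fun n s hs => ?_
  rw [setIntegral_norm_sq_sum_succ hm he hc n hs]
  exact le_add_of_nonneg_right (integral_nonneg fun ω => by positivity)

theorem measure_maxSum_le (hm : ∀ k, StronglyMeasurable[𝒢 (k + 1)] (e k))
    (he : ∀ k, MemLp (e k) 2 μ) (hc : ∀ k, μ[e k | 𝒢 k] =ᵐ[μ] 0) (n : ℕ) {t : ℝ≥0∞}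
    (ht : t ≠ 0) (ht' : t ≠ ∞) :
    μ {ω | t < maxSum e n ω} ≤ (∑ k ∈ Finset.range n, ∫⁻ ω, ‖e k ω‖ₑ ^ 2 ∂μ) / t ^ 2 := by
  lift t to NNReal using ht'
  have hmax := maximal_ineq (submartingale_norm_sq_sum hm he hc) (fun n ω => by positivity)
    (ε := t ^ 2) n
  rw [ENNReal.le_div_iff_mul_le (Or.inl (by simpa using ht)) (Or.inl (by finiteness)), mul_comm]
  have hsub : {ω | (t : ℝ≥0∞) < maxSum e n ω} ⊆ {ω | ((t ^ 2 : NNReal) : ℝ) ≤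
      (Finset.range (n + 1)).sup' Finset.nonempty_range_add_one
        fun k => ‖∑ i ∈ Finset.range k, e i ω‖ ^ 2} := by
    intro ω hω
    obtain ⟨k, hk, hlt⟩ := (Finset.lt_sup_iff).1 (show (t : ℝ≥0∞) < (Finset.range (n +
        1)).sup _ from hω)
    refine le_trans ?_ (Finset.le_sup' (fun k => ‖∑ i ∈ Finset.range k, e i ω‖ ^ 2) hk)
    have h1 : (t : ℝ) ≤ ‖∑ i ∈ Finset.range k, e i ω‖ := by
      rw [← ofReal_norm, ← ENNReal.ofReal_coe_nnreal] at hlt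
      exact ((ENNReal.ofReal_lt_ofReal_iff_of_nonneg t.2).1 hlt).le
    push_cast
    gcongr
  have hN := memLp_sum_diff he n
  calc (t : ℝ≥0∞) ^ 2 * μ {ω | (t : ℝ≥0∞) < maxSum e n ω}
      ≤ ((t ^ 2 : NNReal) : ℝ≥0∞) * μ {ω | ((t ^ 2 : NNReal) : ℝ) ≤
      (Finset.range (n + 1)).sup' Finset.nonempty_range_add_one
        fun k => ‖∑ i ∈ Finset.range k, e i ω‖ ^ 2} := by
        rw [ENNReal.coe_pow]
        exact mul_le_mul_right (measure_mono hsub) _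
    _ ≤ _ := hmax
    _ ≤ ENNReal.ofReal (∫ ω, ‖∑ k ∈ Finset.range n, e k ω‖ ^ 2 ∂μ) := by
        refine ENNReal.ofReal_le_ofReal (setIntegral_le_integral
          (hN.integrable_norm_pow (p := 2) (by norm_num)) (ae_of_all _ fun ω => by positivity))
    _ = ∑ k ∈ Finset.range n, ∫⁻ ω, ‖e k ω‖ₑ ^ 2 ∂μ := by
        rw [integral_norm_sq_sum hm he hc, ENNReal.ofReal_sum_of_nonneg fun k _ =>
            integral_nonneg fun ω => by positivity]
        exact Finset.sum_congr rfl fun k _ => ofReal_integral_norm_sq (he k)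

theorem lintegral_enorm_condExp_le {m : MeasurableSpace Ω} (f : Ω → H) :
    ∫⁻ ω, ‖(μ[f | m]) ω‖ₑ ∂μ ≤ ∫⁻ ω, ‖f ω‖ₑ ∂μ := by
  simpa only [eLpNorm_one_eq_lintegral_enorm] using eLpNorm_condExp_le_eLpNorm (m := m) (μ :=
      μ) f le_rfl

theorem lintegral_enorm_sq_sub_condExp_le {m : MeasurableSpace Ω} {f : Ω → H} (hf : MemLp f 2 μ) :
    ∫⁻ ω, ‖f ω - (μ[f | m]) ω‖ₑ ^ 2 ∂μ ≤ 4 * ∫⁻ ω, ‖f ω‖ₑ ^ 2 ∂μ := by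
  have e2 : ∀ g : Ω → H, ∫⁻ ω, ‖g ω‖ₑ ^ 2 ∂μ = eLpNorm g 2 μ ^ 2 := by
    intro g
    rw [eLpNorm_eq_lintegral_rpow_enorm_toReal (by norm_num) (by norm_num), ← ENNReal.rpow_natCast,
      ← ENNReal.rpow_mul]
    simp
  have e1 := e2 (f - μ[f | m])
  simp only [Pi.sub_apply] at e1
  rw [e1, e2]
  calc eLpNorm (f - μ[f | m]) 2 μ ^ 2 ≤ (eLpNorm f 2 μ + eLpNorm f 2 μ) ^ 2 := by
        gcongr
        refine (eLpNorm_sub_le hf.1 (hf.condExp (by norm_num)).1 (by norm_num)).trans ?_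
        gcongr
        exact eLpNorm_condExp_le_eLpNorm f (by norm_num)
    _ = _ := by ring

theorem minSq_div_eq {t : ℝ≥0∞} (ht : t ≠ 0) (ht' : t ≠ ∞) (y : ℝ≥0∞) :
    minSq (y / t) = (Set.Iic t).indicator (fun y => y ^ 2) y / t ^ 2 +
      (Set.Ioi t).indicator (fun y => y) y / t := by
  rcases le_or_gt y t with h | h
  · have h1 : y / t ≤ 1 := ENNReal.div_le_of_le_mul (by rwa [one_mul])
    rw [Set.indicator_of_mem (Set.mem_Iic.2 h), Set.indicator_of_notMem (by simpa using h), minSq,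
      ENNReal.zero_div, add_zero, min_eq_right (pow_le_of_le_one zero_le h1 (by norm_num))]
    simp only [div_eq_mul_inv, mul_pow, ENNReal.inv_pow]
  · have h1 : 1 ≤ y / t := by
      rw [ENNReal.le_div_iff_mul_le (Or.inl ht) (Or.inl ht'), one_mul]; exact h.le
    rw [Set.indicator_of_mem (Set.mem_Ioi.2 h), Set.indicator_of_notMem (by simpa using h), minSq,
      ENNReal.zero_div, zero_add, min_eq_left (le_self_pow h1 (by norm_num))]

/-- Split `D = g + h` at norm `t`. The recentred `g` are square-integrable martingale differences,
handled by Doob's inequality at level `t`; the recentred `h` are summed in norm and handled by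
Markov's inequality at level `t`. The two costs are the two branches of `minSq`. -/
theorem measure_two_mul_maxSum_le {D : ℕ → Ω → H} {Y : Ω → ℝ≥0∞}
    (hm : ∀ k, StronglyMeasurable[𝒢 (k + 1)] (D k)) (hi : ∀ k, Integrable (D k) μ)
    (hc : ∀ k, μ[D k | 𝒢 k] =ᵐ[μ] 0) (hYm : Measurable Y)
    (hY : ∀ k (φ : ℝ≥0∞ → ℝ≥0∞), Measurable φ → ∫⁻ ω, φ ‖D k ω‖ₑ ∂μ = ∫⁻ ω, φ (Y ω) ∂μ)
    (n : ℕ) {t : ℝ≥0∞} (ht : t ≠ 0) (ht' : t ≠ ∞) :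
    μ {ω | 2 * t < maxSum D n ω} ≤ 4 * n * ∫⁻ ω, minSq (Y ω / t) ∂μ := by
  set A : ℕ → Set Ω := fun k => {ω | ‖D k ω‖ₑ ≤ t} with hA
  have hA𝒢 : ∀ k, MeasurableSet[𝒢 (k + 1)] (A k) := fun k =>
    (hm k).enorm measurableSet_Iic
  have hAm : ∀ k, MeasurableSet (A k) := fun k => 𝒢.le _ _ (hA𝒢 k)
  set g : ℕ → Ω → H := fun k => (A k).indicator (D k) with hg
  set h : ℕ → Ω → H := fun k => (A k)ᶜ.indicator (D k) with hh
  set e : ℕ → Ω → H := fun k => g k - μ[g k | 𝒢 k] with he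
  have hgm : ∀ k, StronglyMeasurable[𝒢 (k + 1)] (g k) := fun k => (hm k).indicator (hA𝒢 k)
  have hgL : ∀ k, MemLp (g k) 2 μ := fun k => by
    refine MemLp.of_bound ((hgm k).mono (𝒢.le _)).aestronglyMeasurable t.toReal
        (ae_of_all _ fun ω => ?_)
    by_cases hω : ω ∈ A k
    · simp only [hg, Set.indicator_of_mem hω]
      rw [← toReal_enorm]
      exact ENNReal.toReal_mono ht' hω
    · simp [hg, Set.indicator_of_notMem hω]
  have hgi : ∀ k, Integrable (g k) μ := fun k => (hgL k).integrable (by norm_num)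
  have hhi : ∀ k, Integrable (h k) μ := fun k => (hi k).indicator (hAm k).compl
  have hem : ∀ k, StronglyMeasurable[𝒢 (k + 1)] (e k) := fun k =>
    (hgm k).sub (stronglyMeasurable_condExp.mono (𝒢.mono (Nat.le_succ k)))
  have heL : ∀ k, MemLp (e k) 2 μ := fun k => (hgL k).sub ((hgL k).condExp (by norm_num))
  have hec : ∀ k, μ[e k | 𝒢 k] =ᵐ[μ] 0 := fun k => by
    refine (condExp_sub (hgi k) integrable_condExp _).trans ?_
    rw [condExp_of_stronglyMeasurable (𝒢.le k) stronglyMeasurable_condExp integrable_condExp,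
        sub_self]
  have hsplit : ∀ k, D k = g k + h k := fun k => (Set.indicator_self_add_compl _ _).symm
  -- Recentring both pieces changes nothing, because the conditional means of `g` and `h` add up to
  -- that of `D`, which is zero.
  have hae : ∀ᵐ ω ∂μ, ∀ k, D k ω = e k ω + (h k ω - (μ[h k | 𝒢 k]) ω) := by
    refine ae_all_iff.2 fun k => ?_
    have h1 := condExp_add (hgi k) (hhi k) (𝒢 k)
    rw [← hsplit k] at h1
    filter_upwards [h1, hc k] with ω h1 h2
    rw [h2, Pi.zero_apply, Pi.add_apply] at h1
    have h3 : (μ[h k | 𝒢 k]) ω = -(μ[g k | 𝒢 k]) ω := (neg_eq_of_add_eq_zero_right h1.symm).symm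
    rw [h3, hsplit k]
    simp only [he, Pi.add_apply, Pi.sub_apply]
    abel
  set B : Ω → ℝ≥0∞ := fun ω => ∑ k ∈ Finset.range n, (‖h k ω‖ₑ + ‖(μ[h k | 𝒢 k]) ω‖ₑ) with hB
  have hterm : ∀ k, AEMeasurable (fun ω => ‖h k ω‖ₑ + ‖(μ[h k | 𝒢 k]) ω‖ₑ) μ := fun k =>
    (hhi k).1.enorm.add integrable_condExp.1.enorm
  have hBm : AEMeasurable B μ := Finset.aemeasurable_fun_sum _ fun k _ => hterm k
  have hle : ∀ᵐ ω ∂μ, maxSum D n ω ≤ maxSum e n ω + B ω := by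
    filter_upwards [hae] with ω hω
    refine Finset.sup_le fun k hk => ?_
    have hkn : k ≤ n := Nat.lt_succ_iff.1 (Finset.mem_range.1 hk)
    simp only [hω]
    rw [Finset.sum_add_distrib]
    refine (enorm_add_le _ _).trans (add_le_add
      (Finset.le_sup (f := fun k => ‖∑ i ∈ Finset.range k, e i ω‖ₑ) hk) ?_)
    refine (enorm_sum_le _ _).trans ((Finset.sum_le_sum fun i _ => enorm_sub_le).trans ?_)
    exact Finset.sum_le_sum_of_subset (Finset.range_mono hkn)
  set G := ∫⁻ ω, (Set.Iic t).indicator (fun y => y ^ 2) (Y ω) ∂μ with hG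
  set K := ∫⁻ ω, (Set.Ioi t).indicator (fun y => y) (Y ω) ∂μ with hK
  have φ1m : Measurable ((Set.Iic t).indicator (fun y : ℝ≥0∞ => y ^ 2)) :=
    (measurable_id.pow_const 2).indicator measurableSet_Iic
  have φ2m : Measurable ((Set.Ioi t).indicator (fun y : ℝ≥0∞ => y)) :=
    measurable_id.indicator measurableSet_Ioi
  have hGe : ∀ k, ∫⁻ ω, ‖e k ω‖ₑ ^ 2 ∂μ ≤ 4 * G := fun k => by
    refine (lintegral_enorm_sq_sub_condExp_le (hgL k)).trans (le_of_eq ?_)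
    rw [hG, ← hY k _ φ1m]
    congr 1
    refine lintegral_congr fun ω => ?_
    by_cases hω : ‖D k ω‖ₑ ≤ t
    · rw [Set.indicator_of_mem (Set.mem_Iic.2 hω)]
      simp only [hg, Set.indicator_of_mem (show ω ∈ A k from hω)]
    · rw [Set.indicator_of_notMem (by simpa using hω)]
      simp [hg, Set.indicator_of_notMem (show ω ∉ A k from hω)]
  have hKe : ∀ k, ∫⁻ ω, ‖h k ω‖ₑ ∂μ = K := fun k => by
    rw [hK, ← hY k _ φ2m]
    refine lintegral_congr fun ω => ?_
    by_cases hω : ‖D k ω‖ₑ ≤ t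
    · rw [Set.indicator_of_notMem (by simpa using hω)]
      simp [hh, Set.indicator_of_notMem (show ω ∉ (A k)ᶜ from fun h => h hω)]
    · rw [Set.indicator_of_mem (Set.mem_Ioi.2 (not_le.1 hω))]
      simp only [hh, Set.indicator_of_mem (show ω ∈ (A k)ᶜ from hω)]
  have hBi : ∫⁻ ω, B ω ∂μ ≤ n * (2 * K) := by
    rw [hB, lintegral_finsetSum' _ fun k _ => hterm k]
    refine (Finset.sum_le_card_nsmul _ _ (2 * K) fun k _ => ?_).trans (by simp)
    rw [lintegral_add_left' (hhi k).1.enorm, two_mul]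
    exact add_le_add (hKe k).le ((lintegral_enorm_condExp_le _).trans (hKe k).le)
  calc μ {ω | 2 * t < maxSum D n ω}
      ≤ μ ({ω | t < maxSum e n ω} ∪ {ω | t ≤ B ω}) := by
        refine measure_mono_ae ?_
        filter_upwards [hle] with ω hω h2
        by_contra hcon
        replace hcon : ω ∉ {ω | t < maxSum e n ω} ∪ {ω | t ≤ B ω} := hcon
        rw [Set.mem_union, not_or] at hcon
        have h3 : maxSum e n ω ≤ t := not_lt.1 hcon.1
        have h4 : B ω ≤ t := (not_le.1 hcon.2).le
        have h5 : 2 * t < maxSum D n ω := h2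
        exact absurd (h5.trans_le (hω.trans (add_le_add h3 h4)))
            (by rw [two_mul]; exact lt_irrefl _)
    _ ≤ (∑ k ∈ Finset.range n, ∫⁻ ω, ‖e k ω‖ₑ ^ 2 ∂μ) / t ^ 2 + (∫⁻ ω, B ω ∂μ) / t :=
        (measure_union_le _ _).trans (add_le_add (measure_maxSum_le hem heL hec n ht ht')
          (meas_ge_le_lintegral_div hBm ht ht'))
    _ ≤ (n * (4 * G)) / t ^ 2 + (n * (4 * K)) / t := by
        refine add_le_add (ENNReal.div_le_div_right ?_ _) (ENNReal.div_le_div_right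
            (hBi.trans ?_) _)
        · refine (Finset.sum_le_card_nsmul _ _ (4 * G) fun k _ => hGe k).trans (by simp)
        · gcongr; norm_num
    _ = 4 * n * (G / t ^ 2 + K / t) := by simp only [div_eq_mul_inv]; ring
    _ = 4 * n * ∫⁻ ω, minSq (Y ω / t) ∂μ := by
        simp only [minSq_div_eq ht ht']
        have m1 : Measurable fun ω => (Set.Iic t).indicator (fun y => y ^ 2) (Y ω) := φ1m.comp hYm
        have m2 : Measurable fun ω => (Set.Ioi t).indicator (fun y => y) (Y ω) := φ2m.comp hYm
        rw [lintegral_add_left (m1.div_const _)]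
        simp only [div_eq_mul_inv]
        rw [lintegral_mul_const _ m1, lintegral_mul_const _ m2]

theorem weakBound_maxSum {D : ℕ → Ω → H} {Y : Ω → ℝ≥0∞}
    (hm : ∀ k, StronglyMeasurable[𝒢 (k + 1)] (D k)) (hi : ∀ k, Integrable (D k) μ)
    (hc : ∀ k, μ[D k | 𝒢 k] =ᵐ[μ] 0) (hYm : Measurable Y)
    (hY : ∀ k (φ : ℝ≥0∞ → ℝ≥0∞), Measurable φ → ∫⁻ ω, φ ‖D k ω‖ₑ ∂μ = ∫⁻ ω, φ (Y ω) ∂μ) :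
    WeakBound μ (maxSum D) Y where
  measurable n := measurable_finset_sup _ fun k =>
    ((stronglyMeasurable_sum_diff hm k).mono (𝒢.le k)).enorm
  measurable_bound := hYm
  mono ω n m hnm := Finset.sup_mono (Finset.range_mono (by omega))
  zero ω := by simp [maxSum]
  ne_top n ω := ((Finset.sup_lt_iff (by simp)).2 fun k _ => enorm_lt_top).ne
  bound n t ht ht' := measure_two_mul_maxSum_le hm hi hc hYm hY n ht ht'

/-- The running maximum of a sequence. -/
noncomputable def runMax (W : ℕ → Ω → ℝ≥0∞) (n : ℕ) (ω : Ω) : ℝ≥0∞ :=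
  (Finset.range n).sup fun k => W k ω

/-- A union bound with Markov's inequality applied to `minSq (W k / t)`, which is at least `1` where
`t ≤ W k`. No dependence structure enters, so this covers the boundary terms left over by the dyadic
pairing. -/
theorem weakBound_runMax {W : ℕ → Ω → ℝ≥0∞} {Y : Ω → ℝ≥0∞} (hW : ∀ k, Measurable (W k))
    (hWt : ∀ k ω, W k ω ≠ ∞) (hYm : Measurable Y)
    (hY : ∀ k (φ : ℝ≥0∞ → ℝ≥0∞), Measurable φ → ∫⁻ ω, φ (W k ω) ∂μ = ∫⁻ ω, φ (Y ω) ∂μ) :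
    WeakBound μ (runMax W) Y where
  measurable n := measurable_finset_sup _ hW
  measurable_bound := hYm
  mono ω n m hnm := Finset.sup_mono (Finset.range_mono hnm)
  zero ω := by simp [runMax]
  ne_top n ω := ((Finset.sup_lt_iff (by simp)).2 fun k _ => (hWt k ω).lt_top).ne
  bound n t ht ht' := by
    have hφ : Measurable fun y => minSq (y / t) := measurable_minSq.comp (measurable_id.div_const t)
    have hk : ∀ k, μ {ω | t ≤ W k ω} ≤ ∫⁻ ω, minSq (Y ω / t) ∂μ := fun k => by
      rw [← hY k _ hφ]
      have hmark := meas_ge_le_lintegral_div (μ := μ) (hφ.comp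
          (hW k)).aemeasurable one_ne_zero ENNReal.one_ne_top
      rw [div_one] at hmark
      refine le_trans ?_ hmark
      refine measure_mono fun ω hω => ?_
      have : 1 ≤ W k ω / t := by
        rw [ENNReal.le_div_iff_mul_le (Or.inl ht) (Or.inl ht'), one_mul]; exact hω
      exact le_min this (one_le_pow₀ this)
    calc μ {ω | 2 * t < runMax W n ω} ≤ μ (⋃ k ∈ Finset.range n, {ω | t ≤ W k ω}) := by
          refine measure_mono fun ω hω => ?_
          obtain ⟨k, hk, hlt⟩ := (Finset.lt_sup_iff).1 (show 2 * t < (Finset.range n).sup _ from hω)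
          refine Set.mem_biUnion hk ?_
          exact (le_mul_of_one_le_left zero_le (by norm_num)).trans hlt.le
      _ ≤ ∑ k ∈ Finset.range n, μ {ω | t ≤ W k ω} := measure_biUnion_finset_le _ _
      _ ≤ n * ∫⁻ ω, minSq (Y ω / t) ∂μ :=
          (Finset.sum_le_card_nsmul _ _ _ fun k _ => hk k).trans (by simp)
      _ ≤ 4 * n * ∫⁻ ω, minSq (Y ω / t) ∂μ := by
          gcongr
          exact le_mul_of_one_le_left zero_le (by norm_num)

end

/-! ### Iterates of the transformation and conditional expectations -/

section

variable {F₀ : MeasurableSpace Ω} {mΩ : MeasurableSpace Ω} (θ : Ω ≃ᵐ Ω)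

theorem iter_add (i j : ℤ) : iter θ (i + j) = iter θ i ∘ iter θ j := by
  funext ω
  simp only [iter, Function.comp_apply, zpow_add]
  rfl

theorem iter_zero : iter θ 0 = id := rfl

theorem iter_iter (i j : ℤ) (ω : Ω) : iter θ i (iter θ j ω) = iter θ (i + j) ω := by
  rw [iter_add]; rfl

theorem sigmaAt_add (i j : ℤ) :
    sigmaAt F₀ θ (i + j) = (sigmaAt F₀ θ i).comap (iter θ j) := by
  unfold sigmaAt
  rw [MeasurableSpace.comap_comp, iter_add]

theorem sigmaAt_zero : sigmaAt F₀ θ 0 = F₀ := by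
  unfold sigmaAt
  rw [iter_zero, MeasurableSpace.comap_id]

variable {θ}

theorem measurePreserving_iter {μ : Measure Ω} (hθ : MeasurePreserving θ μ μ) (i : ℤ) :
    MeasurePreserving (iter θ i) μ μ := by
  have hpos : ∀ n : ℕ, MeasurePreserving (iter θ (n : ℤ)) μ μ := by
    intro n
    induction n with
    | zero => exact MeasurePreserving.id μ
    | succ n ih =>
      rw [Nat.cast_succ, iter_succ]
      exact hθ.comp ih
  obtain ⟨n, rfl | rfl⟩ := i.eq_nat_or_neg
  · exact hpos n
  · refine ⟨measurable_iter θ _, ?_⟩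
    conv_lhs => rw [← (hpos n).map_eq]
    rw [Measure.map_map (measurable_iter θ _) (measurable_iter θ _), ← iter_add, neg_add_cancel,
        iter_zero,
      Measure.map_id]

theorem measurableEmbedding_iter (i : ℤ) : MeasurableEmbedding (iter θ i) := by
  let e : Ω ≃ᵐ Ω :=
    { toFun := iter θ i
      invFun := iter θ (-i)
      left_inv := fun ω => by rw [iter_iter, neg_add_cancel, iter_zero]; rfl
      right_inv := fun ω => by rw [iter_iter, add_neg_cancel, iter_zero]; rfl
      measurable_toFun := measurable_iter θ i
      measurable_invFun := measurable_iter θ (-i) }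
  exact e.measurableEmbedding

theorem sigmaAt_le (hle : F₀ ≤ mΩ) (i : ℤ) : sigmaAt F₀ θ i ≤ mΩ :=
  (MeasurableSpace.comap_mono hle).trans (measurable_iter θ i).comap_le

theorem sigmaAt_mono (hle : F₀ ≤ mΩ) (hmono : F₀ ≤ F₀.comap θ) {i j : ℤ} (hij : i ≤ j) :
    sigmaAt F₀ θ i ≤ sigmaAt F₀ θ j :=
  (filtration F₀ θ hle hmono).mono hij

theorem stronglyMeasurable_comp_iter {E : Type*} [TopologicalSpace E] {f : Ω → E} {s : ℤ}
    (hf : StronglyMeasurable[sigmaAt F₀ θ s] f) (i : ℤ) :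
    StronglyMeasurable[sigmaAt F₀ θ (s + i)] (f ∘ iter θ i) := by
  rw [sigmaAt_add]
  exact hf.comp_measurable (@comap_measurable _ _ (sigmaAt F₀ θ s) _)

variable {μ : Measure Ω}

theorem lintegral_comp_iter (hθ : MeasurePreserving θ μ μ) (i : ℤ) (f : Ω → ℝ≥0∞) :
    ∫⁻ ω, f (iter θ i ω) ∂μ = ∫⁻ ω, f ω ∂μ :=
  (measurePreserving_iter hθ i).lintegral_comp_emb (measurableEmbedding_iter i) f

section

variable [NormedAddCommGroup H]

theorem eLpNorm_comp_iter (hθ : MeasurePreserving θ μ μ) (i : ℤ) {f : Ω → H}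
    (hf : AEStronglyMeasurable f μ) (p : ℝ≥0∞) : eLpNorm (f ∘ iter θ i) p μ = eLpNorm f p μ :=
  eLpNorm_comp_measurePreserving hf (measurePreserving_iter hθ i)

theorem memLp_comp_iter (hθ : MeasurePreserving θ μ μ) (i : ℤ) {f : Ω → H} {p : ℝ≥0∞}
    (hf : MemLp f p μ) : MemLp (f ∘ iter θ i) p μ :=
  hf.comp_measurePreserving (measurePreserving_iter hθ i)

theorem partialSum_eq_sum_range (f : Ω → H) (n : ℕ) (ω : Ω) :
    partialSum θ f n ω = ∑ i ∈ Finset.range n, f (iter θ ((i : ℤ) + 1) ω) := by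
  induction n with
  | zero => simp [partialSum]
  | succ n ih =>
    rw [Finset.sum_range_succ, ← ih, partialSum, partialSum, Finset.sum_Icc_succ_top (by omega)]
    push_cast
    rfl

theorem partialSum_add (f : Ω → H) (m n : ℕ) (ω : Ω) :
    partialSum θ f (m + n) ω = partialSum θ f m ω + partialSum θ f n (iter θ m ω) := by
  simp only [partialSum_eq_sum_range, Finset.sum_range_add, iter_iter]
  congr 1
  refine Finset.sum_congr rfl fun i _ => ?_
  congr 2
  push_cast
  ring

theorem memLp_partialSum (hθ : MeasurePreserving θ μ μ) {f : Ω → H} {p : ℝ≥0∞}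
    (hf : MemLp f p μ) (n : ℕ) : MemLp (partialSum θ f n) p μ :=
  memLp_finsetSum _ fun k _ => memLp_comp_iter hθ k hf

end

variable [NormedAddCommGroup H] [InnerProductSpace ℝ H] [CompleteSpace H] [IsProbabilityMeasure μ]

/-- The events of `ℱ (k+i)` are the preimages under `θ^i` of those of `ℱ k`, so invariance of `μ`
transports the characterizing integrals. -/
theorem condE_comp_iter (hθ : MeasurePreserving θ μ μ) (hle : F₀ ≤ mΩ) (k i : ℤ) {f : Ω → H}
    (hf : Integrable f μ) :
    condE F₀ θ μ (k + i) (f ∘ iter θ i) =ᵐ[μ] condE F₀ θ μ k f ∘ iter θ i := by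
  have hmp := measurePreserving_iter hθ i
  have hE : Integrable (condE F₀ θ μ k f) μ := integrable_condExp
  have hEi : Integrable (condE F₀ θ μ k f ∘ iter θ i) μ := hmp.integrable_comp_of_integrable hE
  refine (ae_eq_condExp_of_forall_setIntegral_eq (sigmaAt_le hle (k + i))
    (hmp.integrable_comp_of_integrable hf) (fun s _ _ => hEi.integrableOn) (fun s hs _ =>
        ?_) ?_).symm
  · rw [sigmaAt_add] at hs
    obtain ⟨t, ht, rfl⟩ := hs
    have e1 := hmp.setIntegral_preimage_emb (measurableEmbedding_iter i) (condE F₀ θ μ k f) t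
    have e2 := hmp.setIntegral_preimage_emb (measurableEmbedding_iter i) f t
    simp only [Function.comp_apply]
    rw [e1, e2]
    exact setIntegral_condExp (sigmaAt_le hle k) hf ht
  · exact (stronglyMeasurable_comp_iter stronglyMeasurable_condExp i).aestronglyMeasurable

/-- The composites `d ∘ θ^(q(k+1))` are martingale differences for the thinned filtration `ℱ (s +
qk)` and all have the law of `d`. -/
theorem weakBound_maxSum_iter (hθ : MeasurePreserving θ μ μ) (hle : F₀ ≤ mΩ)
    (hmono : F₀ ≤ F₀.comap θ) {d : Ω → H} {s : ℤ} {q : ℕ}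
    (hd : StronglyMeasurable[sigmaAt F₀ θ s] d) (hdi : Integrable d μ)
    (hdc : condE F₀ θ μ (s - q) d =ᵐ[μ] 0) :
    WeakBound μ (maxSum fun k => d ∘ iter θ (q * ((k : ℤ) + 1))) fun ω => ‖d ω‖ₑ := by
  let 𝒢 : Filtration ℕ mΩ :=
    { seq := fun k => sigmaAt F₀ θ (s + q * (k : ℤ))
      mono' := fun i j hij => sigmaAt_mono hle hmono (by gcongr)
      le' := fun k => sigmaAt_le hle _ }
  refine weakBound_maxSum (𝒢 := 𝒢) (fun k => ?_)
    (fun k => (measurePreserving_iter hθ _).integrable_comp_of_integrable hdi) (fun k => ?_)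
    (hd.mono (sigmaAt_le hle s)).enorm (fun k φ hφ => lintegral_comp_iter hθ _ fun ω => φ ‖d ω‖ₑ)
  · have := stronglyMeasurable_comp_iter hd (q * ((k : ℤ) + 1))
    change StronglyMeasurable[sigmaAt F₀ θ (s + q * ((k + 1 : ℕ) : ℤ))] _
    exact this
  · have h := condE_comp_iter hθ hle (s - q) (q * ((k : ℤ) + 1)) hdi
    have e : s - q + q * ((k : ℤ) + 1) = s + q * (k : ℤ) := by ring
    rw [e] at h
    refine h.trans ?_
    exact (measurePreserving_iter hθ _).quasiMeasurePreserving.ae_eq_comp hdc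

theorem weakBound_runMax_iter (hθ : MeasurePreserving θ μ μ) {u : Ω → H} {q : ℕ}
    (hu : StronglyMeasurable u) :
    WeakBound μ (runMax fun k ω => ‖u (iter θ (q * ((k : ℤ) + 1)) ω)‖ₑ) fun ω => ‖u ω‖ₑ :=
  weakBound_runMax (fun _ => hu.enorm.comp (measurable_iter θ _)) (fun _ _ => enorm_ne_top) hu.enorm
    fun _ φ _ => lintegral_comp_iter hθ _ fun ω => φ ‖u ω‖ₑ

end

/-! ### The projection condition -/

section

variable {F₀ : MeasurableSpace Ω} {mΩ : MeasurableSpace Ω} {θ : Ω ≃ᵐ Ω} {μ : Measure Ω}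
  [NormedAddCommGroup H] {p : ℝ}

theorem eLpNorm_ofReal_eq (hp : 0 < p) (f : Ω → H) :
    eLpNorm f (ENNReal.ofReal p) μ = (∫⁻ ω, ‖f ω‖ₑ ^ p ∂μ) ^ (1 / p) := by
  rw [eLpNorm_eq_lintegral_rpow_enorm_toReal
      (by simpa using hp) (by simp), ENNReal.toReal_ofReal hp.le]

theorem lintegral_rpow_ne_top (hp : 0 < p) {f : Ω → H} (hf : MemLp f (ENNReal.ofReal p) μ) :
    ∫⁻ ω, ‖f ω‖ₑ ^ p ∂μ ≠ ∞ := by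
  have h := hf.2
  rw [eLpNorm_ofReal_eq hp, ENNReal.rpow_lt_top_iff_of_pos (by positivity)] at h
  exact h.ne

theorem enorm_partialSum_le_maxSum (f : Ω → H) (n : ℕ) (ω : Ω) :
    ‖partialSum θ f n ω‖ₑ ≤ maxSum (fun k => f ∘ iter θ ((1 : ℕ) * ((k : ℤ) + 1))) n ω := by
  rw [partialSum_eq_sum_range]
  refine le_trans (le_of_eq ?_) (enorm_sum_le_maxSum _ n ω)
  simp

variable [InnerProductSpace ℝ H] [CompleteSpace H] [IsProbabilityMeasure μ]

theorem eLpNorm_condE_comp_iter (hθ : MeasurePreserving θ μ μ) (hle : F₀ ≤ mΩ) (k i : ℤ) {f : Ω → H}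
    (hf : Integrable f μ) (q : ℝ≥0∞) :
    eLpNorm (condE F₀ θ μ (k + i) (f ∘ iter θ i)) q μ = eLpNorm (condE F₀ θ μ k f) q μ := by
  rw [eLpNorm_congr_ae (condE_comp_iter hθ hle k i hf)]
  exact eLpNorm_comp_iter hθ i integrable_condExp.1 q

theorem condE_condE (hle : F₀ ≤ mΩ) (hmono : F₀ ≤ F₀.comap θ) {i j : ℤ} (hij : i ≤ j) (f : Ω → H) :
    condE F₀ θ μ i (condE F₀ θ μ j f) =ᵐ[μ] condE F₀ θ μ i f :=
  condExp_condExp_of_le (sigmaAt_mono hle hmono hij) (sigmaAt_le hle j)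

theorem condE_of_stronglyMeasurable (hle : F₀ ≤ mΩ) {i : ℤ} {f : Ω → H}
    (hf : StronglyMeasurable[sigmaAt F₀ θ i] f) (hfi : Integrable f μ) : condE F₀ θ μ i f = f :=
  condExp_of_stronglyMeasurable (sigmaAt_le hle i) hf hfi

theorem condE_sub_condE (hle : F₀ ≤ mΩ) (hmono : F₀ ≤ F₀.comap θ) {i j : ℤ} (hij : i ≤ j) (f : Ω →
    H) :
    condE F₀ θ μ i (condE F₀ θ μ j f - condE F₀ θ μ i f) =ᵐ[μ] 0 := by
  refine (condExp_sub integrable_condExp integrable_condExp _).trans ?_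
  filter_upwards [condE_condE hle hmono hij f, condE_condE hle hmono (le_refl i) f] with ω h1 h2
  simp only [condE] at h1 h2 ⊢
  simp [h1, h2]

/-- Telescoping `X = ∑_{j<J} d_j + E_{-J} X` with `d_j = E_{-j} X - E_{-j-1} X`. Each `d_j` is a
martingale difference whose norm, by stationarity, is that of `P_0 (X_j)`, so `negligible_tsum`
applies with all steps equal to `1`. -/
theorem exists_negligible_of_tsum_proj (hθ : MeasurePreserving θ μ μ) (hle : F₀ ≤ mΩ)
    (hmono : F₀ ≤ F₀.comap θ) (hp1 : 1 < p) (hp2 : p < 2) {X : Ω → H}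
        (hX : StronglyMeasurable[F₀] X)
    (hXp : MemLp X (ENNReal.ofReal p) μ)
    (hsum : ∑' n : ℕ, eLpNorm (proj F₀ θ μ 0 (X ∘ iter θ (n : ℤ))) (ENNReal.ofReal p) μ ≠ ∞)
    (hlim : Tendsto (fun n : ℕ => eLpNorm (condE F₀ θ μ 0 (X ∘ iter θ (n : ℤ)))
      (ENNReal.ofReal p) μ) atTop (𝓝 0)) :
    ∃ Z, Negligible μ p Z ∧ ∀ᵐ ω ∂μ, ∀ n, ‖partialSum θ X n ω‖ₑ ≤ Z n ω := by
  have hp0 : 0 < p := by linarith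
  have hp1' : 1 ≤ ENNReal.ofReal p := by simpa using hp1.le
  have hXi : Integrable X μ := hXp.integrable hp1'
  set g : ℕ → Ω → H := fun j => condE F₀ θ μ (-(j : ℤ)) X with hg
  set d : ℕ → Ω → H := fun j => g j - g (j + 1) with hd
  have hgi : ∀ j, Integrable (g j) μ := fun j => integrable_condExp
  have hgm : ∀ j : ℕ, StronglyMeasurable[sigmaAt F₀ θ (-(j : ℤ))] (g j) := fun j =>
      stronglyMeasurable_condExp
  have hg0 : g 0 = X := by
    have hX0 : StronglyMeasurable[sigmaAt F₀ θ (-((0 : ℕ) : ℤ))] X := by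
      rw [Nat.cast_zero, neg_zero, sigmaAt_zero]; exact hX
    exact condE_of_stronglyMeasurable hle hX0 hXi
  have hgnorm : ∀ j, eLpNorm (g j) (ENNReal.ofReal p) μ =
      eLpNorm (condE F₀ θ μ 0 (X ∘ iter θ (j : ℤ))) (ENNReal.ofReal p) μ := fun j => by
    rw [← eLpNorm_condE_comp_iter hθ hle (-(j : ℤ)) j hXi, neg_add_cancel]
  have hdnorm : ∀ j, eLpNorm (d j) (ENNReal.ofReal p) μ =
      eLpNorm (proj F₀ θ μ 0 (X ∘ iter θ (j : ℤ))) (ENNReal.ofReal p) μ := fun j => by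
    rw [← eLpNorm_comp_iter hθ j ((hgi j).sub (hgi (j + 1))).1]
    refine eLpNorm_congr_ae ?_
    have h1 := condE_comp_iter hθ hle (-(j : ℤ)) j hXi
    have h2 := condE_comp_iter hθ hle (-((j + 1 : ℕ) : ℤ)) j hXi
    have e1 : -(j : ℤ) + j = 0 := by ring
    have e2 : -((j + 1 : ℕ) : ℤ) + j = 0 - 1 := by push_cast; ring
    rw [e1] at h1
    rw [e2] at h2
    filter_upwards [h1, h2] with ω h1 h2
    simp only [proj, Pi.sub_apply, h1, h2, hg, Function.comp_apply]
  have hW : ∀ j, WeakBound μ (maxSum fun k => d j ∘ iter θ ((1 : ℕ) * ((k : ℤ) + 1))) fun ω =>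
      ‖d j ω‖ₑ := by
    intro j
    refine weakBound_maxSum_iter hθ hle hmono (s := -(j : ℤ))
      ((hgm j).sub ((hgm (j + 1)).mono (sigmaAt_mono hle hmono (by push_cast; omega))))
      ((hgi j).sub (hgi (j + 1))) ?_
    have := condE_sub_condE (μ := μ) (θ := θ) hle hmono (show -((j + 1 : ℕ) : ℤ) ≤
        -(j : ℤ) by push_cast; omega) X
    have e : -(j : ℤ) - (1 : ℕ) = -((j + 1 : ℕ) : ℤ) := by push_cast; ring
    rw [e]
    exact this
  refine ⟨_, negligible_tsum hp1 hp2 (q := fun _ => 1) (fun _ => one_ne_zero) hW ?_, ?_⟩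
  · simp only [Nat.cast_one, ENNReal.one_rpow, div_one]
    simpa only [← eLpNorm_ofReal_eq hp0, hdnorm] using hsum
  · simp only [Nat.div_one]
    refine ae_all_iff.2 fun n => ?_
    set r : ℕ → Ω → ℝ≥0∞ := fun j ω => ‖partialSum θ (g j) n ω‖ₑ with hr
    have hpm : ∀ j, StronglyMeasurable (partialSum θ (g j) n) := fun j =>
      Finset.stronglyMeasurable_fun_sum _ fun k _ =>
        ((hgm j).mono (sigmaAt_le hle _)).comp_measurable (measurable_iter θ k)
    have hrint : ∀ j, ∫⁻ ω, r j ω ∂μ ≤ n * eLpNorm (g j) (ENNReal.ofReal p) μ := by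
      intro j
      calc ∫⁻ ω, r j ω ∂μ ≤ ∫⁻ ω, ∑ k ∈ Finset.Icc 1 n, ‖g j (iter θ (k : ℤ) ω)‖ₑ ∂μ :=
            lintegral_mono fun ω => enorm_sum_le _ _
        _ = ∑ k ∈ Finset.Icc 1 n, ∫⁻ ω, ‖g j (iter θ (k : ℤ) ω)‖ₑ ∂μ :=
            lintegral_finsetSum' _ fun k _ =>
              ((measurePreserving_iter hθ k).integrable_comp_of_integrable (hgi j)).1.enorm
        _ = n * ∫⁻ ω, ‖g j ω‖ₑ ∂μ := by
            rw [Finset.sum_congr rfl fun (k : ℕ) _ => lintegral_comp_iter hθ (k : ℤ) fun ω =>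
                ‖g j ω‖ₑ]
            simp
        _ ≤ n * eLpNorm (g j) (ENNReal.ofReal p) μ := by
            rw [← eLpNorm_one_eq_lintegral_enorm]
            gcongr
            exact eLpNorm_le_eLpNorm_of_exponent_le hp1' (hgi j).1
    have hlim0 : Tendsto (fun j => ∫⁻ ω, r j ω ∂μ) atTop (𝓝 0) := by
      have h0 : Tendsto (fun j : ℕ => n * eLpNorm (g j) (ENNReal.ofReal p) μ) atTop (𝓝 (n * 0)) :=
          by
        simp only [hgnorm]
        exact ENNReal.Tendsto.const_mul hlim (Or.inr (by finiteness))
      rw [mul_zero] at h0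
      exact tendsto_of_tendsto_of_tendsto_of_le_of_le tendsto_const_nhds h0 (fun _ => zero_le) hrint
    -- The remainder tends to `0` in `L¹`; Fatou turns this into a vanishing almost sure lower
    -- limit, which suffices because the bound `hJ` holds for every `J`.
    have hliminf : ∀ᵐ ω ∂μ, liminf (fun j => r j ω) atTop = 0 := by
      have h1 := lintegral_liminf_le' (μ := μ) (f := r) (u := atTop) fun j =>
          (hpm j).enorm.aemeasurable
      rw [hlim0.liminf_eq, nonpos_iff_eq_zero] at h1
      exact (lintegral_eq_zero_iff (Measurable.liminf fun j => (hpm j).enorm)).1 h1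
    filter_upwards [hliminf] with ω hω
    set z := ∑' j, maxSum (fun k => d j ∘ iter θ ((1 : ℕ) * ((k : ℤ) + 1))) n ω with hz
    have hJ : ∀ J, ‖partialSum θ X n ω‖ₑ ≤ z + r J ω := by
      intro J
      have hsplit : partialSum θ X n ω =
          (∑ j ∈ Finset.range J, partialSum θ (d j) n ω) + partialSum θ (g J) n ω := by
        simp only [partialSum]
        rw [Finset.sum_comm, ← Finset.sum_add_distrib]
        refine Finset.sum_congr rfl fun k _ => ?_
        simp only [hd, Pi.sub_apply]
        rw [Finset.sum_range_sub', hg0, sub_add_cancel]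
      rw [hsplit]
      refine (enorm_add_le _ _).trans (add_le_add ?_ le_rfl)
      refine (enorm_sum_le _ _).trans (le_trans ?_ (ENNReal.sum_le_tsum (Finset.range J)))
      exact Finset.sum_le_sum fun j _ => enorm_partialSum_le_maxSum (d j) n ω
    refine ENNReal.le_of_forall_pos_le_add fun ε hε _ => ?_
    have hfreq : ∃ᶠ j in atTop, r j ω < ε := by
      refine frequently_lt_of_liminf_lt (by isBoundedDefault) ?_
      rw [hω]
      exact_mod_cast hε
    obtain ⟨J, hJε⟩ := hfreq.exists
    exact (hJ J).trans (by gcongr)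

end

/-! ### Dyadic pairing of sums along multiples of powers of two -/

theorem sum_range_two_mul {E : Type*} [AddCommMonoid E] (a : ℕ → E) (m : ℕ) :
    ∑ i ∈ Finset.range (2 * m), a i = ∑ i ∈ Finset.range m, (a (2 * i) + a (2 * i + 1)) := by
  induction m with
  | zero => simp
  | succ m ih => rw [Nat.mul_succ, Finset.sum_range_succ, Finset.sum_range_succ, ih,
      Finset.sum_range_succ, add_assoc]

section

variable {F₀ : MeasurableSpace Ω} {mΩ : MeasurableSpace Ω} (θ : Ω ≃ᵐ Ω) {μ : Measure Ω}
  [NormedAddCommGroup H] {p : ℝ}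

/-- The partial sums of `f` along the multiples of `q`. -/
def sparseSum (f : Ω → H) (q n : ℕ) (ω : Ω) : H :=
  ∑ i ∈ Finset.range n, f (iter θ (q * ((i : ℤ) + 1)) ω)

/-- The difference between a function summed over blocks of two consecutive dyadic times and the
next function in a dyadic sequence. -/
def dyadicDiff (u : ℕ → Ω → H) (r : ℕ) : Ω → H :=
  u r ∘ iter θ (-((2 ^ r : ℕ) : ℤ)) + u r - u (r + 1)

/-- The times `2^r(2i+1)` and `2^r(2i+2)` are paired: the second is `2^(r+1)(i+1)` and the first is
its shift by `-2^r`. An odd `n` leaves the last time unpaired. -/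
theorem sparseSum_dyadic (u : ℕ → Ω → H) (r n : ℕ) (ω : Ω) :
    sparseSum θ (u r) (2 ^ r) n ω = sparseSum θ (dyadicDiff θ u r) (2 ^ (r + 1)) (n / 2) ω +
      sparseSum θ (u (r + 1)) (2 ^ (r + 1)) (n / 2) ω +
      if Odd n then u r (iter θ ((2 ^ r : ℕ) * (n : ℤ)) ω) else 0 := by
  have heven : ∀ m : ℕ, sparseSum θ (u r) (2 ^ r) (2 * m) ω =
      sparseSum θ (dyadicDiff θ u r) (2 ^ (r + 1)) m ω + sparseSum θ (u (r + 1)) (2 ^ (r +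
          1)) m ω := by
    intro m
    unfold sparseSum
    rw [sum_range_two_mul, ← Finset.sum_add_distrib]
    refine Finset.sum_congr rfl fun i _ => ?_
    simp only [dyadicDiff, Pi.sub_apply, Pi.add_apply, Function.comp_apply, iter_iter,
        sub_add_cancel]
    congr 3 <;> push_cast <;> ring
  rcases Nat.even_or_odd' n with ⟨m, rfl | rfl⟩
  · rw [Nat.mul_div_cancel_left _ two_pos, if_neg (by simp), add_zero, heven]
  · have h2 : (2 * m + 1) / 2 = m := by omega
    rw [h2, if_pos (odd_two_mul_add_one m), ← heven]
    conv_lhs => rw [sparseSum, Finset.sum_range_succ]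
    rw [sparseSum]
    push_cast
    rfl

theorem enorm_sparseSum_le (u : ℕ → Ω → H) (ω : Ω) (n K : ℕ) :
    ‖sparseSum θ (u 0) 1 n ω‖ₑ ≤
      ∑ r ∈ Finset.range K,
        (maxSum (fun k => dyadicDiff θ u r ∘ iter θ ((2 ^ (r + 1) : ℕ) * ((k : ℤ) + 1))) (n / 2 ^
            (r + 1)) ω +
        runMax (fun k ω => ‖u r (iter θ ((2 ^ r : ℕ) * ((k : ℤ) + 1)) ω)‖ₑ) (n / 2 ^ r) ω) +
      ‖sparseSum θ (u K) (2 ^ K) (n / 2 ^ K) ω‖ₑ := by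
  induction K with
  | zero => simp
  | succ K ih =>
    refine ih.trans ?_
    rw [Finset.sum_range_succ, add_assoc]
    refine add_le_add le_rfl ?_
    have hdiv : n / 2 ^ K / 2 = n / 2 ^ (K + 1) := by rw [Nat.div_div_eq_div_mul, pow_succ]
    rw [sparseSum_dyadic, hdiv]
    -- The unpaired term is the last entry of the running maximum over `n / 2^K` terms.
    have hodd : ‖(if Odd (n / 2 ^ K) then u K (iter θ ((2 ^ K : ℕ) *
        ((n / 2 ^ K : ℕ) : ℤ)) ω) else 0)‖ₑ ≤
        runMax (fun k ω => ‖u K (iter θ ((2 ^ K : ℕ) * ((k : ℤ) + 1)) ω)‖ₑ) (n / 2 ^ K) ω := by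
      split_ifs with h
      · obtain ⟨m, hm⟩ : ∃ m, n / 2 ^ K = m + 1 := ⟨n / 2 ^ K - 1, by have := h.pos; omega⟩
        rw [hm]
        refine le_trans (le_of_eq ?_) (Finset.le_sup
          (f := fun k : ℕ => ‖u K (iter θ ((2 ^ K : ℕ) * ((k : ℤ) + 1)) ω)‖ₑ)
              (Finset.self_mem_range_succ m))
        push_cast
        rfl
      · simp
    calc _ ≤ ‖sparseSum θ (dyadicDiff θ u K) (2 ^ (K + 1)) (n / 2 ^ (K + 1)) ω‖ₑ +
          ‖sparseSum θ (u (K + 1)) (2 ^ (K + 1)) (n / 2 ^ (K + 1)) ω‖ₑ + _ :=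
          (enorm_add_le _ _).trans (add_le_add (enorm_add_le _ _) le_rfl)
      _ ≤ maxSum (fun k => dyadicDiff θ u K ∘ iter θ ((2 ^ (K + 1) : ℕ) * ((k : ℤ) + 1))) (n / 2 ^
          (K + 1)) ω +
          ‖sparseSum θ (u (K + 1)) (2 ^ (K + 1)) (n / 2 ^ (K + 1)) ω‖ₑ + _ := by
          refine add_le_add (add_le_add (enorm_sum_le_maxSum _ _ ω) le_rfl) hodd
      _ = _ := by ring

/-- After `n` pairings nothing remains, since `n < 2^n`; the bound therefore requires no convergence
of `u`. -/
theorem enorm_sparseSum_le_tsum (u : ℕ → Ω → H) (ω : Ω) (n : ℕ) :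
    ‖sparseSum θ (u 0) 1 n ω‖ₑ ≤
      (∑' r, maxSum (fun k => dyadicDiff θ u r ∘ iter θ ((2 ^ (r + 1) : ℕ) * ((k : ℤ) + 1)))
        (n / 2 ^ (r + 1)) ω) +
      ∑' r, runMax (fun k ω => ‖u r (iter θ ((2 ^ r : ℕ) * ((k : ℤ) + 1)) ω)‖ₑ) (n / 2 ^ r) ω := by
  refine (enorm_sparseSum_le θ u ω n n).trans ?_
  rw [Nat.div_eq_of_lt n.lt_two_pow_self, ← ENNReal.tsum_add]
  simp only [sparseSum, Finset.range_zero, Finset.sum_empty, enorm_zero, add_zero]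
  exact ENNReal.sum_le_tsum _

end

/-! ### Subadditivity and growth of the conditional norms -/

section

variable {F₀ : MeasurableSpace Ω} {mΩ : MeasurableSpace Ω} {θ : Ω ≃ᵐ Ω} {μ : Measure Ω}
  [NormedAddCommGroup H] [InnerProductSpace ℝ H] [CompleteSpace H] [IsProbabilityMeasure μ] {p : ℝ}

/-- The second block is `S_n ∘ θ^m`; projecting first onto `ℱ m`, contraction and stationarity bound
its `E_0` by `‖E_0 S_n‖`. -/
theorem eLpNorm_condE_partialSum_add_le (hθ : MeasurePreserving θ μ μ) (hle : F₀ ≤ mΩ)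
    (hmono : F₀ ≤ F₀.comap θ) {X : Ω → H} {q : ℝ≥0∞} (hq : 1 ≤ q) (hX : MemLp X q μ) (m n : ℕ) :
    eLpNorm (condE F₀ θ μ 0 (partialSum θ X (m + n))) q μ ≤
      eLpNorm (condE F₀ θ μ 0 (partialSum θ X m)) q μ + eLpNorm (condE F₀ θ μ 0
          (partialSum θ X n)) q μ := by
  have hi : ∀ k, Integrable (partialSum θ X k) μ := fun k =>
      (memLp_partialSum hθ hX k).integrable hq
  have hi' : Integrable (partialSum θ X n ∘ iter θ m) μ :=
    (measurePreserving_iter hθ m).integrable_comp_of_integrable (hi n)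
  have hsplit : partialSum θ X (m + n) = partialSum θ X m + partialSum θ X n ∘ iter θ m :=
    funext fun ω => partialSum_add X m n ω
  have hE : condE F₀ θ μ 0 (partialSum θ X (m + n)) =ᵐ[μ]
      condE F₀ θ μ 0 (partialSum θ X m) + condE F₀ θ μ 0 (partialSum θ X n ∘ iter θ m) := by
    rw [hsplit]
    exact condExp_add (hi m) hi' _
  rw [eLpNorm_congr_ae hE]
  refine (eLpNorm_add_le integrable_condExp.1 integrable_condExp.1 hq).trans (add_le_add le_rfl ?_)
  have e := eLpNorm_congr_ae (p := q) (condE_condE (μ := μ) hle hmono (show (0 : ℤ) ≤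
      m by positivity)
    (partialSum θ X n ∘ iter θ m))
  refine e.symm.trans_le ?_
  refine (eLpNorm_condExp_le_eLpNorm (condE F₀ θ μ m (partialSum θ X n ∘ iter θ m)) hq).trans
      (le_of_eq ?_)
  have := eLpNorm_condE_comp_iter hθ hle 0 m (hi n) q
  rwa [zero_add] at this

/-- Averaging `a N ≤ a i + a (N-i)` over `i` bounds `N a(N)` by a multiple of `∑_{i<N} a i`. In this
range the weights are at least `log 2 / N^(3/2)`, so that sum is `O(N^(3/2))`. -/
theorem subadditive_le_sqrt {a : ℕ → ℝ≥0∞} (ha : ∀ m n, a (m + n) ≤ a m + a n)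
    (hsum : ∑' n : ℕ, ENNReal.ofReal (Real.log ((n : ℝ) + 2) / ((n : ℝ) + 2) ^ (3 / 2 : ℝ)) * a (n +
        2) ≠ ∞) :
    ∃ K : ℝ≥0∞, K ≠ ∞ ∧ ∀ M : ℕ, a (M + 4) ≤ K * ((M + 4 : ℕ) : ℝ≥0∞) ^ (1 / 2 : ℝ) := by
  set A := ∑' n : ℕ, ENNReal.ofReal (Real.log ((n : ℝ) + 2) / ((n : ℝ) + 2) ^ (3 / 2 : ℝ)) * a (n +
      2) with hA
  have hlog2 : 0 < Real.log 2 := Real.log_pos (by norm_num)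
  set c := ENNReal.ofReal (Real.log 2) with hc
  have hc0 : c ≠ 0 := by simpa [hc] using hlog2
  have hct : c ≠ ∞ := ENNReal.ofReal_ne_top
  -- The factor `8` is `2` from the symmetrized average times `4` from `M + 4 ≤ 4(M + 1)`. The
  -- offset `4` lets both summands have index at least `2`, where the series starts.
  refine ⟨8 * A / c, ENNReal.div_ne_top (by finiteness) hc0, fun M => ?_⟩
  set N : ℝ≥0∞ := ((M + 4 : ℕ) : ℝ≥0∞) with hN
  have hN0 : N ≠ 0 := by simp [hN]
  have hNt : N ≠ ∞ := by simp [hN]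
  have hNr : ∀ s : ℝ, N ^ s = ENNReal.ofReal (((M + 4 : ℕ) : ℝ) ^ s) := fun s => by
    rw [← ENNReal.ofReal_rpow_of_pos (by positivity), ENNReal.ofReal_natCast]
  have h1 : (M + 1 : ℕ) * a (M + 4) ≤ 2 * ∑ i ∈ Finset.range (M + 1), a (i + 2) := by
    calc (M + 1 : ℕ) * a (M + 4) = ∑ i ∈ Finset.range (M + 1), a (M + 4) := by simp
      _ ≤ ∑ i ∈ Finset.range (M + 1), (a (i + 2) + a (M + 1 - 1 - i + 2)) := by
          refine Finset.sum_le_sum fun i hi => ?_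
          have : M + 4 = (i + 2) + (M + 1 - 1 - i + 2) := by have := Finset.mem_range.1 hi; omega
          rw [this]
          refine (ha _ _).trans (le_of_eq ?_)
          congr 2
      _ = 2 * ∑ i ∈ Finset.range (M + 1), a (i + 2) := by
          rw [Finset.sum_add_distrib, Finset.sum_range_reflect (fun i => a (i + 2)), two_mul]
  have h2 : c / N ^ (3 / 2 : ℝ) * ∑ i ∈ Finset.range (M + 1), a (i + 2) ≤ A := by
    rw [Finset.mul_sum]
    refine (Finset.sum_le_sum fun i hi => ?_).trans (ENNReal.sum_le_tsum (Finset.range (M + 1)))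
    have hiM := Finset.mem_range.1 hi
    gcongr
    rw [hNr, ← ENNReal.ofReal_div_of_pos (by positivity)]
    refine ENNReal.ofReal_le_ofReal ?_
    have h3 : Real.log 2 ≤ Real.log ((i : ℝ) + 2) := Real.log_le_log
        (by norm_num) (by linarith [(Nat.cast_nonneg i : (0 : ℝ) ≤ i)])
    have h4 : ((i : ℝ) + 2) ^ (3 / 2 : ℝ) ≤ ((M + 4 : ℕ) : ℝ) ^ (3 / 2 : ℝ) := by
      refine Real.rpow_le_rpow (by positivity) ?_ (by norm_num)
      exact_mod_cast (by omega : i + 2 ≤ M + 4)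
    exact div_le_div₀ (hlog2.le.trans h3) h3 (by positivity) h4
  have h3 : N ≤ 4 * (M + 1 : ℕ) := by
    rw [hN]; exact_mod_cast (by omega : M + 4 ≤ 4 * (M + 1))
  have hsq : N ^ (3 / 2 : ℝ) = N * N ^ (1 / 2 : ℝ) := by
    rw [show (3 / 2 : ℝ) = 1 + 1 / 2 by norm_num, ENNReal.rpow_add _ _ hN0 hNt, ENNReal.rpow_one]
  have hN20 : N ^ (3 / 2 : ℝ) ≠ 0 := (ENNReal.rpow_pos (pos_iff_ne_zero.2 hN0) hNt).ne'
  have hN2t : N ^ (3 / 2 : ℝ) ≠ ∞ := by finiteness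
  have h4 : ∑ i ∈ Finset.range (M + 1), a (i + 2) ≤ A / c * N ^ (3 / 2 : ℝ) := by
    rw [mul_comm, ← ENNReal.le_div_iff_mul_le
        (by simp [hc0, hN2t]) (by simp [hct, hN20, ENNReal.div_eq_top])] at h2
    refine h2.trans (le_of_eq ?_)
    simp only [div_eq_mul_inv]
    rw [ENNReal.mul_inv (Or.inl hc0) (Or.inl hct), inv_inv, mul_assoc]
  have h5 : N * a (M + 4) ≤ N * (8 * A / c * N ^ (1 / 2 : ℝ)) := by
    calc N * a (M + 4) ≤ 4 * (M + 1 : ℕ) * a (M + 4) := by gcongr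
      _ = 4 * ((M + 1 : ℕ) * a (M + 4)) := by ring
      _ ≤ 4 * (2 * (A / c * N ^ (3 / 2 : ℝ))) := by
          refine mul_le_mul_right (h1.trans (mul_le_mul_right h4 _)) _
      _ = _ := by rw [hsq]; simp only [div_eq_mul_inv]; ring
  exact (ENNReal.mul_le_mul_iff_right hN0 hNt).1 h5

/-- Square-root growth makes the terms geometric of ratio `2^(1/2 - 1/p) < 1`; the terms `r = 0, 1`,
outside the range of the growth bound, are merely finite. -/
theorem tsum_dyadic_ne_top {a : ℕ → ℝ≥0∞} (hp0 : 0 < p) (hp2 : p < 2) (hat : ∀ n,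
    a n ≠ ∞) {K : ℝ≥0∞}
    (hK : K ≠ ∞) (ha : ∀ M : ℕ, a (M + 4) ≤ K * ((M + 4 : ℕ) : ℝ≥0∞) ^ (1 / 2 : ℝ)) :
    ∑' r : ℕ, a (2 ^ r) / ((2 ^ r : ℕ) : ℝ≥0∞) ^ (1 / p) ≠ ∞ := by
  have hdiv : ∀ r : ℕ, a (2 ^ r) / ((2 ^ r : ℕ) : ℝ≥0∞) ^ (1 / p) ≠ ∞ := fun r =>
    ENNReal.div_ne_top (hat _) (by simp [ENNReal.rpow_eq_zero_iff])
  rw [← Summable.sum_add_tsum_nat_add' (k := 2) ENNReal.summable]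
  refine ENNReal.add_ne_top.2 ⟨(ENNReal.sum_lt_top.2 fun r _ => (hdiv r).lt_top).ne, ?_⟩
  set ρ : ℝ≥0∞ := 2 ^ (1 / 2 - 1 / p) with hρ
  have hρ1 : ρ < 1 := by
    refine ENNReal.rpow_lt_one_of_one_lt_of_neg (by norm_num) ?_
    rw [sub_neg]
    exact one_div_lt_one_div_of_lt hp0 hp2
  have hterm : ∀ r : ℕ, a (2 ^ (r + 2)) / ((2 ^ (r + 2) : ℕ) : ℝ≥0∞) ^ (1 / p) ≤ K * ρ ^ r := by
    intro r
    have h4 : 2 ^ (r + 2) = (2 ^ (r + 2) - 4) + 4 := by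
      have : 4 ≤ 2 ^ (r + 2) := by
        calc 4 = 2 ^ 2 := by norm_num
          _ ≤ _ := Nat.pow_le_pow_right (by norm_num) (by omega)
      omega
    have h5 := ha (2 ^ (r + 2) - 4)
    rw [← h4] at h5
    calc a (2 ^ (r + 2)) / ((2 ^ (r + 2) : ℕ) : ℝ≥0∞) ^ (1 / p)
        ≤ K * ((2 ^ (r + 2) : ℕ) : ℝ≥0∞) ^ (1 / 2 : ℝ) / ((2 ^ (r + 2) : ℕ) : ℝ≥0∞) ^ (1 / p) :=
          ENNReal.div_le_div_right h5 _
      _ = K * ρ ^ (r + 2) := by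
          rw [mul_div_assoc, ← ENNReal.rpow_sub _ _ (by simp) (by simp), hρ]
          push_cast
          rw [← ENNReal.rpow_natCast, ← ENNReal.rpow_mul, ← ENNReal.rpow_natCast,
              ← ENNReal.rpow_mul, mul_comm (((r + 2 : ℕ) : ℝ))]
      _ ≤ K * ρ ^ r := by
          exact mul_le_mul_right (pow_le_pow_right_of_le_one' hρ1.le (Nat.le_add_right r 2)) K
  refine ne_top_of_le_ne_top ?_ (ENNReal.tsum_le_tsum hterm)
  rw [ENNReal.tsum_mul_left, ENNReal.tsum_geometric]
  exact ENNReal.mul_ne_top hK (ENNReal.inv_ne_top.2 (tsub_pos_of_lt hρ1).ne')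

end

/-! ### The approximating martingale and the condition on partial sums -/

section

variable {F₀ : MeasurableSpace Ω} {mΩ : MeasurableSpace Ω} {θ : Ω ≃ᵐ Ω} {μ : Measure Ω}
  [NormedAddCommGroup H] [InnerProductSpace ℝ H] [CompleteSpace H] [IsProbabilityMeasure μ] {p : ℝ}

/-- The stationary martingale difference `X - E (X | ℱ_{-1})`. For `p < 2` the partial sums of any
stationary martingale difference in `L^p` are `o (n ^ (1 / p))`,
    so that at this rate the quality of a
martingale approximation does not depend on the choice of the difference. -/
noncomputable def innovation (F₀ : MeasurableSpace Ω) {mΩ : MeasurableSpace Ω} (θ : Ω ≃ᵐ Ω)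
    (μ : Measure Ω) (X : Ω → H) : Ω → H :=
  X - condE F₀ θ μ (-1) X

theorem stronglyMeasurable_innovation (hle : F₀ ≤ mΩ) (hmono : F₀ ≤ F₀.comap θ) {X : Ω → H}
    (hX : StronglyMeasurable[F₀] X) : StronglyMeasurable[sigmaAt F₀ θ 0] (innovation F₀ θ μ X) := by
  have hX0 : StronglyMeasurable[sigmaAt F₀ θ 0] X := by rw [sigmaAt_zero]; exact hX
  exact hX0.sub (stronglyMeasurable_condExp.mono (sigmaAt_mono hle hmono (by norm_num)))

theorem memLp_innovation {X : Ω → H} {q : ℝ≥0∞} (hq : 1 ≤ q) (hX : MemLp X q μ) :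
    MemLp (innovation F₀ θ μ X) q μ := hX.sub (hX.condExp hq)

theorem condE_innovation (hle : F₀ ≤ mΩ) (hmono : F₀ ≤ F₀.comap θ) {X : Ω → H}
    (hX : StronglyMeasurable[F₀] X) (hXi : Integrable X μ) :
    condE F₀ θ μ (-1) (innovation F₀ θ μ X) =ᵐ[μ] 0 := by
  have hX0 : StronglyMeasurable[sigmaAt F₀ θ 0] X := by rw [sigmaAt_zero]; exact hX
  have h := condE_sub_condE (μ := μ) (θ := θ) hle hmono (show (-1 : ℤ) ≤ 0 by norm_num) X
  rwa [condE_of_stronglyMeasurable hle hX0 hXi] at h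

theorem weakBound_innovation (hθ : MeasurePreserving θ μ μ) (hle : F₀ ≤ mΩ)
    (hmono : F₀ ≤ F₀.comap θ) {X : Ω → H} (hX : StronglyMeasurable[F₀] X) (hXi : Integrable X μ) :
    WeakBound μ (maxSum fun k => innovation F₀ θ μ X ∘ iter θ ((1 : ℕ) * ((k : ℤ) + 1)))
      fun ω => ‖innovation F₀ θ μ X ω‖ₑ :=
  weakBound_maxSum_iter hθ hle hmono (stronglyMeasurable_innovation hle hmono hX)
    (hXi.sub integrable_condExp) (by simpa using condE_innovation hle hmono hX hXi)

theorem negligible_innovation (hθ : MeasurePreserving θ μ μ) (hle : F₀ ≤ mΩ)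
    (hmono : F₀ ≤ F₀.comap θ) (hp1 : 1 < p) (hp2 : p < 2) {X : Ω → H}
        (hX : StronglyMeasurable[F₀] X)
    (hXp : MemLp X (ENNReal.ofReal p) μ) :
    Negligible μ p (maxSum fun k => innovation F₀ θ μ X ∘ iter θ ((1 : ℕ) * ((k : ℤ) + 1))) := by
  have hp1' : 1 ≤ ENNReal.ofReal p := by simpa using hp1.le
  exact (weakBound_innovation hθ hle hmono hX (hXp.integrable hp1')).negligible hp1 hp2
    (lintegral_rpow_ne_top (by linarith) (memLp_innovation hp1' hXp))

theorem martingale_partialSum_innovation (hθ : MeasurePreserving θ μ μ) (hle : F₀ ≤ mΩ)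
    (hmono : F₀ ≤ F₀.comap θ) {X : Ω → H} (hX : StronglyMeasurable[F₀] X) (hXi : Integrable X μ) :
    Martingale (fun n : ℕ => partialSum θ (innovation F₀ θ μ X) (n + 1))
      (posFiltration F₀ θ hle hmono) μ := by
  set D := innovation F₀ θ μ X with hD
  have hDi : Integrable D μ := hXi.sub integrable_condExp
  have hDm : StronglyMeasurable[sigmaAt F₀ θ 0] D := stronglyMeasurable_innovation hle hmono hX
  refine martingale_of_condExp_sub_eq_zero_nat (fun n => ?_) (fun n => ?_) fun n => ?_
  · refine Finset.stronglyMeasurable_fun_sum _ fun k hk => ?_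
    have h := stronglyMeasurable_comp_iter hDm k
    rw [zero_add] at h
    refine h.mono (sigmaAt_mono hle hmono ?_)
    have := (Finset.mem_Icc.1 hk).2
    exact_mod_cast this
  · exact (memLp_partialSum hθ (memLp_one_iff_integrable.2 hDi) _).integrable le_rfl
  · have hdiff : partialSum θ D (n + 1 + 1) - partialSum θ D (n + 1) = D ∘ iter θ ((n : ℤ) + 2) :=
        by
      funext ω
      rw [Pi.sub_apply, partialSum_eq_sum_range, partialSum_eq_sum_range, Finset.sum_range_succ _
          (n + 1),
        add_sub_cancel_left, Function.comp_apply]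
      congr 2
    rw [hdiff]
    have h := condE_comp_iter hθ hle (-1) ((n : ℤ) + 2) hDi
    rw [show (-1 : ℤ) + ((n : ℤ) + 2) = n + 1 by ring] at h
    exact h.trans ((measurePreserving_iter hθ _).quasiMeasurePreserving.ae_eq_comp
      (condE_innovation hle hmono hX hXi))

/-- Consistency of the dyadic scheme: by the tower property, conditioning the paired `u_r` on `ℱ
(-2^(r+1))` gives `u_{r+1}`, since `S_{2q}` is two blocks of length `q`. Hence `dyadicDiff` has zero
conditional mean. -/
theorem condE_shift_add (hθ : MeasurePreserving θ μ μ) (hle : F₀ ≤ mΩ) (hmono : F₀ ≤ F₀.comap θ)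
    {X : Ω → H} (hX : Integrable X μ) (q : ℕ) {v : Ω → H}
    (hv : v = condE F₀ θ μ (-(q : ℤ)) (partialSum θ X q ∘ iter θ (-(q : ℤ)))) :
    condE F₀ θ μ (-((2 * q : ℕ) : ℤ)) (v ∘ iter θ (-(q : ℤ)) + v) =ᵐ[μ]
      condE F₀ θ μ (-((2 * q : ℕ) : ℤ)) (partialSum θ X (2 * q) ∘ iter θ (-((2 * q : ℕ) : ℤ))) := by
  set S := partialSum θ X q with hS
  have hSi : Integrable S μ := (memLp_partialSum hθ
      (memLp_one_iff_integrable.2 hX) q).integrable le_rfl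
  have hi : ∀ (f : Ω → H) (i : ℤ), Integrable f μ → Integrable (f ∘ iter θ i) μ := fun f i hf =>
    (measurePreserving_iter hθ i).integrable_comp_of_integrable hf
  have hvi : Integrable v μ := by rw [hv]; exact integrable_condExp
  have e2 : -((2 * q : ℕ) : ℤ) = -(q : ℤ) + -(q : ℤ) := by push_cast; ring
  have h1 : condE F₀ θ μ (-((2 * q : ℕ) : ℤ)) (v ∘ iter θ (-(q : ℤ))) =ᵐ[μ]
      condE F₀ θ μ (-((2 * q : ℕ) : ℤ)) (S ∘ iter θ (-((2 * q : ℕ) : ℤ))) := by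
    have a1 := condE_comp_iter hθ hle (-(q : ℤ)) (-(q : ℤ)) hvi
    have a2 := condE_comp_iter hθ hle (-(q : ℤ)) (-(q : ℤ)) (hi S (-(q : ℤ)) hSi)
    have a3 : condE F₀ θ μ (-(q : ℤ)) v = v := by
      rw [hv]
      exact condE_of_stronglyMeasurable hle stronglyMeasurable_condExp integrable_condExp
    rw [a3] at a1
    rw [← hv] at a2
    have a4 : (S ∘ iter θ (-(q : ℤ))) ∘ iter θ (-(q : ℤ)) = S ∘ iter θ (-((2 * q : ℕ) : ℤ)) := by
      rw [Function.comp_assoc, ← iter_add, e2]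
    rw [a4, ← e2] at a2
    rw [← e2] at a1
    exact a1.trans a2.symm
  have h2 : condE F₀ θ μ (-((2 * q : ℕ) : ℤ)) v =ᵐ[μ]
      condE F₀ θ μ (-((2 * q : ℕ) : ℤ)) (S ∘ iter θ (-(q : ℤ))) := by
    rw [hv]
    exact condE_condE hle hmono (by push_cast; omega) _
  have h3 : partialSum θ X (2 * q) ∘ iter θ (-((2 * q : ℕ) : ℤ)) =
      S ∘ iter θ (-((2 * q : ℕ) : ℤ)) + S ∘ iter θ (-(q : ℤ)) := by
    funext ω
    simp only [Function.comp_apply, Pi.add_apply]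
    rw [two_mul, partialSum_add, iter_iter]
    congr 3
    push_cast
    ring
  rw [h3]
  refine (condExp_add (hi v _ hvi) hvi _).trans ((h1.add h2).trans ?_)
  exact (condExp_add (hi S _ hSi) (hi S _ hSi) _).symm

/-- Three negligible processes add up: the innovation, the series of maxima of the dyadic
differences, and the series of running maxima of unpaired terms. Both series are controlled by `∑
‖E_0 S_{2^r}‖_p / 2^(r/p)`. -/
theorem exists_negligible_of_tsum_partialSum (hθ : MeasurePreserving θ μ μ) (hle : F₀ ≤ mΩ)
    (hmono : F₀ ≤ F₀.comap θ) (hp1 : 1 < p) (hp2 : p < 2) {X : Ω → H}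
        (hX : StronglyMeasurable[F₀] X)
    (hXp : MemLp X (ENNReal.ofReal p) μ)
    (hsum : ∑' n : ℕ, ENNReal.ofReal (Real.log ((n : ℝ) + 2) / ((n : ℝ) + 2) ^ (3 / 2 : ℝ)) *
      eLpNorm (condE F₀ θ μ 0 (partialSum θ X (n + 2))) (ENNReal.ofReal p) μ ≠ ∞) :
    ∃ Z, Negligible μ p Z ∧ ∀ᵐ ω ∂μ, ∀ n, ‖partialSum θ X n ω‖ₑ ≤ Z n ω := by
  have hp0 : 0 < p := by linarith
  have hp1' : 1 ≤ ENNReal.ofReal p := by simpa using hp1.le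
  have hXi : Integrable X μ := hXp.integrable hp1'
  set a : ℕ → ℝ≥0∞ := fun n => eLpNorm (condE F₀ θ μ 0 (partialSum θ X n))
      (ENNReal.ofReal p) μ with ha
  have hat : ∀ n, a n ≠ ∞ := fun n => ((memLp_partialSum hθ hXp n).condExp hp1').2.ne
  obtain ⟨K, hKt, hK⟩ := subadditive_le_sqrt
    (eLpNorm_condE_partialSum_add_le hθ hle hmono hp1' hXp) hsum
  have hdy : ∑' r : ℕ, a (2 ^ r) / ((2 ^ r : ℕ) : ℝ≥0∞) ^ (1 / p) ≠ ∞ :=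
      tsum_dyadic_ne_top hp0 hp2 hat hKt hK
  set u : ℕ → Ω → H := fun r =>
    condE F₀ θ μ (-((2 ^ r : ℕ) : ℤ)) (partialSum θ X (2 ^ r) ∘ iter θ (-((2 ^ r : ℕ) : ℤ))) with hu
  have hSi : ∀ n, Integrable (partialSum θ X n) μ := fun n =>
      (memLp_partialSum hθ hXp n).integrable hp1'
  have hui : ∀ r, Integrable (u r) μ := fun r => integrable_condExp
  have hum : ∀ r : ℕ, StronglyMeasurable[sigmaAt F₀ θ (-((2 ^ r : ℕ) : ℤ))] (u r) :=
    fun r => stronglyMeasurable_condExp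
  have hunorm : ∀ r, eLpNorm (u r) (ENNReal.ofReal p) μ = a (2 ^ r) := fun r => by
    have := eLpNorm_condE_comp_iter hθ hle 0 (-((2 ^ r : ℕ) : ℤ)) (hSi (2 ^ r)) (ENNReal.ofReal p)
    rwa [zero_add] at this
  have hu' : ∀ r, Integrable (u r ∘ iter θ (-((2 ^ r : ℕ) : ℤ))) μ := fun r =>
    (measurePreserving_iter hθ _).integrable_comp_of_integrable (hui r)
  have hdi : ∀ r, Integrable (dyadicDiff θ u r) μ := fun r => ((hu' r).add (hui r)).sub (hui (r +
      1))
  have hdm : ∀ r, StronglyMeasurable[sigmaAt F₀ θ 0] (dyadicDiff θ u r) := fun r => by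
    have hle0 : ∀ i : ℕ, sigmaAt F₀ θ (-(i : ℤ)) ≤ sigmaAt F₀ θ 0 := fun i =>
      sigmaAt_mono hle hmono (by omega)
    refine StronglyMeasurable.sub (StronglyMeasurable.add ?_ ((hum r).mono (hle0 _))) ((hum (r +
        1)).mono (hle0 _))
    -- The shifted `u r` is measurable for the still older σ-algebra `ℱ (-2^(r+1))`, hence for `ℱ
    -- 0`.
    have h0 : (0 : ℤ) ≤ ((2 ^ r : ℕ) : ℤ) := by positivity
    exact (stronglyMeasurable_comp_iter (hum r) _).mono (sigmaAt_mono hle hmono (by linarith))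
  have hdc : ∀ r, condE F₀ θ μ (0 - ((2 ^ (r + 1) : ℕ) : ℤ)) (dyadicDiff θ u r) =ᵐ[μ] 0 := fun r =>
      by
    have h1 := condE_shift_add (μ := μ) hθ hle hmono hXi (2 ^ r) (v := u r) rfl
    rw [show 2 * 2 ^ r = 2 ^ (r + 1) by rw [pow_succ, mul_comm]] at h1
    have h2 : condE F₀ θ μ (-((2 ^ (r + 1) : ℕ) : ℤ)) (u (r + 1)) = u (r + 1) :=
      condE_of_stronglyMeasurable hle (hum (r + 1)) (hui (r + 1))
    rw [zero_sub]
    refine (condExp_sub ((hu' r).add (hui r)) (hui (r + 1)) _).trans ?_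
    filter_upwards [h1] with ω h1
    have h2' := congrFun h2 ω
    simp only [condE] at h1 h2'
    rw [Pi.sub_apply, h1, h2', Pi.zero_apply, sub_eq_zero]
    rfl
  have hdnorm : ∀ r, eLpNorm (dyadicDiff θ u r) (ENNReal.ofReal p) μ ≤ 2 * a (2 ^ r) + a (2 ^ (r +
      1)) := fun r => by
    refine (eLpNorm_sub_le ((hu' r).add (hui r)).1 (hui (r + 1)).1 hp1').trans ?_
    rw [hunorm, two_mul]
    refine add_le_add ((eLpNorm_add_le (hu' r).1 (hui r).1 hp1').trans (le_of_eq ?_)) le_rfl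
    rw [eLpNorm_comp_iter hθ _ (hui r).1, hunorm]
  have hneg_d := negligible_tsum (μ := μ) hp1 hp2 (q := fun r => 2 ^ (r + 1)) (fun r =>
      by positivity)
    (fun r => weakBound_maxSum_iter hθ hle hmono (hdm r) (hdi r) (hdc r)) (by
      simp only [← eLpNorm_ofReal_eq hp0]
      have hb : ∀ r : ℕ, eLpNorm (dyadicDiff θ u r) (ENNReal.ofReal p) μ / ((2 ^ (r +
          1) : ℕ) : ℝ≥0∞) ^ (1 / p) ≤
          2 * (a (2 ^ r) / ((2 ^ r : ℕ) : ℝ≥0∞) ^ (1 / p)) +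
            a (2 ^ (r + 1)) / ((2 ^ (r + 1) : ℕ) : ℝ≥0∞) ^ (1 / p) := fun r => by
        refine (ENNReal.div_le_div_right (hdnorm r) _).trans ?_
        rw [ENNReal.add_div, mul_div_assoc]
        refine add_le_add (mul_le_mul_right (ENNReal.div_le_div_left (ENNReal.rpow_le_rpow ?_
            (by positivity)) _) _) le_rfl
        exact_mod_cast Nat.pow_le_pow_right (by norm_num) (Nat.le_succ r)
      refine ne_top_of_le_ne_top ?_ (ENNReal.tsum_le_tsum hb)
      rw [ENNReal.tsum_add, ENNReal.tsum_mul_left]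
      refine ENNReal.add_ne_top.2 ⟨ENNReal.mul_ne_top (by norm_num) hdy, ne_top_of_le_ne_top hdy ?_⟩
      exact ENNReal.tsum_comp_le_tsum_of_injective (f := fun r : ℕ => r + 1) (add_left_injective 1)
        (fun r : ℕ => a (2 ^ r) / ((2 ^ r : ℕ) : ℝ≥0∞) ^ (1 / p)))
  have hneg_u := negligible_tsum (μ := μ) hp1 hp2 (q := fun r => 2 ^ r) (fun r => by positivity)
    (fun r => weakBound_runMax_iter (q := 2 ^ r) hθ ((hum r).mono (sigmaAt_le hle _))) (by
      simpa only [← eLpNorm_ofReal_eq hp0, hunorm] using hdy)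
  refine ⟨_, (negligible_innovation hθ hle hmono hp1 hp2 hX hXp).add hp1.le
      (hneg_d.add hp1.le hneg_u),
    ae_of_all _ fun ω n => ?_⟩
  -- At `r = 0` the block is one shifted term, so `u 0 = E_{-1} X`, exactly what the innovation
  -- subtracts.
  have hsplit : partialSum θ X n ω = partialSum θ (innovation F₀ θ μ X) n ω + sparseSum θ
      (u 0) 1 n ω := by
    have hS1 : partialSum θ X (2 ^ 0) ∘ iter θ (-((2 ^ 0 : ℕ) : ℤ)) = X := by
      funext ω
      simp [partialSum, iter_iter, iter_zero]
    have hu0 : u 0 = condE F₀ θ μ (-1) X := by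
      simp only [hu, hS1]
      norm_num
    rw [sparseSum, partialSum_eq_sum_range, partialSum_eq_sum_range, ← Finset.sum_add_distrib]
    refine Finset.sum_congr rfl fun i _ => ?_
    simp [hu0, innovation]
  rw [hsplit]
  exact (enorm_add_le _ _).trans (add_le_add (enorm_partialSum_le_maxSum _ n ω)
      (enorm_sparseSum_le_tsum θ u ω n))

theorem tendsto_toReal_div {x : ℕ → ℝ≥0∞}
    (h : Tendsto (fun n : ℕ => x n / (n : ℝ≥0∞) ^ (1 / p)) atTop (𝓝 0)) :
    (fun n : ℕ => (x n).toReal) =o[atTop] fun n : ℕ => (n : ℝ) ^ (1 / p) := by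
  refine (isLittleO_iff_tendsto' ?_).2 ?_
  · filter_upwards [eventually_ne_atTop 0] with n hn h0
    exact absurd h0 (Real.rpow_pos_of_pos (by positivity) _).ne'
  · have := (ENNReal.tendsto_toReal ENNReal.zero_ne_top).comp h
    refine this.congr fun n => ?_
    simp only [Function.comp_apply]
    rw [ENNReal.toReal_div, ← ENNReal.toReal_rpow, ENNReal.toReal_natCast]

theorem Negligible.ae_isLittleO {Z : ℕ → Ω → ℝ≥0∞} (hZ : Negligible μ p Z) {S : ℕ → Ω → H}
    (hS : ∀ᵐ ω ∂μ, ∀ n, ‖S n ω‖ₑ ≤ Z n ω) :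
    ∀ᵐ ω ∂μ, (fun n : ℕ => ‖S n ω‖) =o[atTop] fun n : ℕ => (n : ℝ) ^ (1 / p) := by
  filter_upwards [hZ.ae_tendsto, hS] with ω h1 h2
  have h3 := tendsto_of_tendsto_of_tendsto_of_le_of_le tendsto_const_nhds h1 (fun _ => zero_le)
    fun n => ENNReal.div_le_div_right (h2 n) ((n : ℝ≥0∞) ^ (1 / p))
  simpa only [toReal_enorm] using tendsto_toReal_div h3

theorem Negligible.eLpNorm_isLittleO (hp : 0 < p) {Z : ℕ → Ω → ℝ≥0∞} (hZ : Negligible μ p Z)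
    {S : ℕ → Ω → H} (hS : ∀ᵐ ω ∂μ, ∀ n, ‖S n ω‖ₑ ≤ Z n ω) :
    (fun n : ℕ => (eLpNorm (S n) (ENNReal.ofReal p) μ).toReal) =o[atTop] fun n : ℕ => (n : ℝ) ^
        (1 / p) := by
  refine tendsto_toReal_div (tendsto_of_tendsto_of_tendsto_of_le_of_le tendsto_const_nhds
    hZ.tendsto_norm (fun _ => zero_le) fun n => ENNReal.div_le_div_right ?_ _)
  rw [eLpNorm_ofReal_eq hp]
  refine ENNReal.rpow_le_rpow (lintegral_mono_ae ?_) (by positivity)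
  filter_upwards [hS] with ω h
  exact ENNReal.rpow_le_rpow (h n) hp.le

/-- The weights are bounded below by `log 2`, and the two terms missing from the weighted series are
finite. -/
theorem tsum_ne_top_of_log_mul {b : ℕ → ℝ≥0∞} (hb : ∀ n, b n ≠ ∞)
    (h : ∑' n : ℕ, ENNReal.ofReal (Real.log ((n : ℝ) + 2)) * b (n + 2) ≠ ∞) : ∑' n, b n ≠ ∞ := by
  rw [← Summable.sum_add_tsum_nat_add' (k := 2) ENNReal.summable]
  refine ENNReal.add_ne_top.2 ⟨(ENNReal.sum_lt_top.2 fun r _ => (hb r).lt_top).ne, ?_⟩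
  have hc : ENNReal.ofReal (Real.log 2) ≠ 0 :=
      by simpa using Real.log_pos (by norm_num : (1 : ℝ) < 2)
  have hle : ENNReal.ofReal (Real.log 2) * ∑' n : ℕ, b (n + 2) ≤
      ∑' n : ℕ, ENNReal.ofReal (Real.log ((n : ℝ) + 2)) * b (n + 2) := by
    rw [← ENNReal.tsum_mul_left]
    refine ENNReal.tsum_le_tsum fun n => ?_
    gcongr
    linarith [(Nat.cast_nonneg n : (0 : ℝ) ≤ n)]
  intro htop
  rw [htop, ENNReal.mul_top hc] at hle
  exact h (top_le_iff.1 hle)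

end

end StationaryApprox

/-! ### The main theorem -/

theorem mainTheorem5 {Ω H : Type*} (F₀ : MeasurableSpace Ω) {mΩ : MeasurableSpace Ω}
    [NormedAddCommGroup H] [InnerProductSpace ℝ H] [CompleteSpace H]
    [TopologicalSpace.SeparableSpace H]
    (μ : Measure Ω) [IsProbabilityMeasure μ]
    (θ : Ω ≃ᵐ Ω) (hθ : MeasurePreserving θ μ μ)
    (hle : F₀ ≤ mΩ) (hmono : F₀ ≤ F₀.comap θ)
    (p : ℝ) (hp1 : 1 < p) (hp2 : p < 2)
    (X₀ : Ω → H) (hX₀ : StronglyMeasurable[F₀] X₀)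
    (hXp : MemLp X₀ (ENNReal.ofReal p) μ) (hXc : ∫ ω, X₀ ω ∂μ = 0)
    (hcond :
      (∑' n : ℕ, ENNReal.ofReal (Real.log ((n : ℝ) + 2) / ((n : ℝ) + 2) ^ (3 / 2 : ℝ)) *
          eLpNorm (StationaryApprox.condE F₀ θ μ 0 (StationaryApprox.partialSum θ X₀ (n + 2)))
            (ENNReal.ofReal p) μ < ∞) ∨
      ((∑' n : ℕ, ENNReal.ofReal (Real.log ((n : ℝ) + 2)) *
          eLpNorm (StationaryApprox.proj F₀ θ μ 0
            (X₀ ∘ StationaryApprox.iter θ ((n : ℤ) + 2))) (ENNReal.ofReal p) μ < ∞) ∧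
        Tendsto (fun n : ℕ => eLpNorm (StationaryApprox.condE F₀ θ μ 0
            (X₀ ∘ StationaryApprox.iter θ (n : ℤ))) (ENNReal.ofReal p) μ) atTop (𝓝 0))) :
    StationaryApprox.HasMartingaleApprox F₀ θ hle hmono μ X₀ p
        (fun n : ℕ => (n : ℝ) ^ (1 / p)) ∧
      ∀ᵐ ω ∂μ, (fun n : ℕ => ‖StationaryApprox.partialSum θ X₀ n ω‖)
        =o[atTop] (fun n : ℕ => (n : ℝ) ^ (1 / p)) := by
  open StationaryApprox in
  have hp0 : 0 < p := by linarith
  have hp1' : 1 ≤ ENNReal.ofReal p := by simpa using hp1.le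
  have hXi : Integrable X₀ μ := hXp.integrable hp1'
  obtain ⟨Z, hZ, hSZ⟩ : ∃ Z, Negligible μ p Z ∧ ∀ᵐ ω ∂μ, ∀ n, ‖partialSum θ X₀ n ω‖ₑ ≤ Z n ω := by
    rcases hcond with h | ⟨h, hlim⟩
    · exact exists_negligible_of_tsum_partialSum hθ hle hmono hp1 hp2 hX₀ hXp h.ne
    · refine exists_negligible_of_tsum_proj hθ hle hmono hp1 hp2 hX₀ hXp ?_ hlim
      refine tsum_ne_top_of_log_mul (fun n => ?_) (by exact_mod_cast h.ne)
      have hn := memLp_comp_iter hθ n hXp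
      exact ((hn.condExp hp1').sub (hn.condExp hp1')).2.ne
  refine ⟨⟨innovation F₀ θ μ X₀, memLp_innovation hp1' hXp,
    martingale_partialSum_innovation hθ hle hmono hX₀ hXi, ?_⟩, hZ.ae_isLittleO hSZ⟩
  -- Both `S_n` and `M_n` are negligible separately, so their difference is dominated by a sum of
  -- two negligible processes.
  refine (hZ.add hp1.le
      (negligible_innovation hθ hle hmono hp1 hp2 hX₀ hXp)).eLpNorm_isLittleO hp0 ?_
  filter_upwards [hSZ] with ω h n
  exact enorm_sub_le.trans (add_le_add (h n) (enorm_partialSum_le_maxSum _ n ω))
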